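/- Let $d,q\ge 1$, let $U\subseteq\mathbb{R}^d$ be a nonempty open set, let $(\Omega,\mathcal F,\mathbb P)$ be a probability space, and let $\mathbf v\in L^2_{\mathbb P}(\Omega;L^2(U;\mathbb R^q))$ (Bochner space), with mean $\mathbb E[\mathbf v]=\int_\Omega \mathbf v\,d\mathbb P\in L^2(U;\mathbb R^q)$. Then $\mathbf v$ has a version $\mathbf v(\mathbf x,\omega)$ that is measurable with respect to the product measure on $U\times\Omega$ (up to null sets). For every such version, $\mathbf v(\mathbf x,\cdot)\in L^2(\Omega)$ and $\mathbb E[\mathbf v](\mathbf x)=\int_\Omega\mathbf v(\mathbf x,\omega)\,d\mathbb P$ for almost every $\mathbf x\in U$; the matrix-valued covariance function $\mathrm{Cov}(\mathbf v(\mathbf x),\mathbf v(\mathbf y))=[\mathrm{Cov}(v_i(\mathbf x),v_j(\mathbf y))]_{i,j}$ has entries in $L^2(U\times U)$; and the covariance operator $$(\mathcal C_{\mathbf v}\mathbf u)(\mathbf x)=\int_U \mathrm{Cov}(\mathbf v(\mathbf x),\mathbf v(\mathbf y))\,\mathbf u(\mathbf y)\,d\mathbf y$$ maps $L^2(U;\mathbb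 R^q)$ to itself. An eigensystem of $\mathcal C_{\mathbf v}$ is a sequence $\lambda_1\ge\lambda_2\ge\dots\ge 0$ and an orthonormal sequence $(\boldsymbol\phi_k)$ in $L^2(U;\mathbb R^q)$ with $\mathcal C_{\mathbf v}\boldsymbol\phi_k=\lambda_k\boldsymbol\phi_k$ for all $k$, such that every eigenfunction of $\mathcal C_{\mathbf v}$ for a nonzero eigenvalue lies in the closed linear span of $\{\boldsymbol\phi_k\}_k$. An eigensystem exists, and for every eigensystem the following hold, with $Y_k(\omega)=\lambda_k^{-1/2}\int_U(\mathbf v(\mathbf x,\omega)-\mathbb E[\mathbf v](\mathbf x))^{\rm T}\boldsymbol\phi_k(\mathbf x)\,d\mathbf x$ when $\lambda_k>0$ (and $Y_k=0$ when $\lambda_k=0$). 1. $\sum_k\lambda_k<\infty$ and $Y_k\in L^2_{\mathbb P}(\Omega)$ for all $k$; moreover $\mathbb E[Y_k]=0$ and $\mathbb E[Y_kY_l]=\delta_{kl}$ for all $k,l$ with $\lambda_k,\lambda_l>0$. 2. $\mathbf v=\mathbb E[\mathbf v]+\sum_k\lambda_k^{1/2}\boldsymbol\phi_kY_k$, with unconditional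 convergence in $L^2_{\mathbb P}(\Omega;L^2(U;\mathbb R^q))$. 3. Let $\mathbf w=\mathbf v-\mathbb E[\mathbf v]$ and $M\ge 0$. For a finite-dimensional subspace $H\subset L^2(U;\mathbb R^q)$ let $P_{H\otimes L^2_{\mathbb P}(\Omega)}$ be the orthogonal projection of $L^2_{\mathbb P}(\Omega;L^2(U;\mathbb R^q))$ onto the closed span of the elements $\omega\mapsto s(\omega)\boldsymbol\phi$ with $\boldsymbol\phi\in H$, $s\in L^2_{\mathbb P}(\Omega)$. Then $$\min_{\dim H=M}\bigl\|\mathbf w-P_{H\otimes L^2_{\mathbb P}(\Omega)}\mathbf w\bigr\|_{L^2_{\mathbb P}(\Omega;L^2(U;\mathbb R^q))}=\Bigl(\sum_{k\ge M+1}\lambda_k\Bigr)^{1/2},$$ and the minimum is attained at $H=\mathrm{span}\{\boldsymbol\phi_1,\dots,\boldsymbol\phi_M\}$. A subspace $H$ of dimension $M$ attains it if and only if $H$ has an orthonormal basis $\psi_1,\dots,\psi_M$ with $\mathcal C_{\mathbf v}\psi_i=\lambda_i\psi_i$ for all $i\le M$. If $\lambda_{M+1}<\lambda_i$ for all $i\le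 M$, it is attained only at $H=\mathrm{span}\{\boldsymbol\phi_1,\dots,\boldsymbol\phi_M\}$. -/

import Mathlib

open MeasureTheory ProbabilityTheory Filter Topology

noncomputable section

/-- The Hilbert space `L²(U; ℝ^q)` for `U ⊆ ℝ^d` with Lebesgue measure. -/
abbrev L2Field {d : ℕ} (U : Set (EuclideanSpace ℝ (Fin d))) (q : ℕ) : Type :=
  Lp (EuclideanSpace ℝ (Fin q)) 2 (volume.restrict U)

variable {d q : ℕ} {Ω : Type*} [MeasurableSpace Ω]

/-- The Bochner space `L²_P(Ω; L²(U; ℝ^q))` of square-integrable random vector fields. -/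
abbrev RandomField (P : Measure Ω) (U : Set (EuclideanSpace ℝ (Fin d))) (q : ℕ) : Type _ :=
  Lp (L2Field U q) 2 P

/-- The mean field `E[v]`, an element of `L²(U; ℝ^q)`. -/
def meanField {P : Measure Ω} {U : Set (EuclideanSpace ℝ (Fin d))}
    (v : RandomField P U q) : L2Field U q :=
  ∫ ω, v ω ∂P

/-- `V` is a version `v(x, ω)` of the random field `v`, jointly measurable in `(x, ω)` up to
null sets: for almost every `ω`, the function `x ↦ V x ω` represents the class `v ω`. -/
structure IsPointwiseVersion {P : Measure Ω} {U : Set (EuclideanSpace ℝ (Fin d))}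
    (v : RandomField P U q) (V : EuclideanSpace ℝ (Fin d) → Ω → EuclideanSpace ℝ (Fin q)) :
    Prop where
  aestronglyMeasurable : AEStronglyMeasurable (Function.uncurry V) ((volume.restrict U).prod P)
  ae_eq : ∀ᵐ ω ∂P, (fun x => V x ω) =ᵐ[volume.restrict U] v ω

/-- The matrix-valued covariance function, with entries `Cov(v_i(x), v_j(y))`. -/
def covMatrix (P : Measure Ω) (V : EuclideanSpace ℝ (Fin d) → Ω → EuclideanSpace ℝ (Fin q))
    (x y : EuclideanSpace ℝ (Fin d)) : Matrix (Fin q) (Fin q) ℝ :=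
  Matrix.of fun i j => cov[fun ω => V x ω i, fun ω => V y ω j; P]

/-- The covariance operator `(C u)(x) = ∫_U Cov(v(x), v(y)) u(y) dy`. -/
def covOp (P : Measure Ω) (U : Set (EuclideanSpace ℝ (Fin d)))
    (V : EuclideanSpace ℝ (Fin d) → Ω → EuclideanSpace ℝ (Fin q))
    (u : EuclideanSpace ℝ (Fin d) → EuclideanSpace ℝ (Fin q))
    (x : EuclideanSpace ℝ (Fin d)) : EuclideanSpace ℝ (Fin q) :=
  ∫ y in U, WithLp.toLp 2 (Matrix.mulVec (covMatrix P V x y) (u y))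

/-- `u ∈ L²(U; ℝ^q)` satisfies `C u = μ u` (almost everywhere on `U`). -/
def CovEigen (P : Measure Ω) {U : Set (EuclideanSpace ℝ (Fin d))}
    (V : EuclideanSpace ℝ (Fin d) → Ω → EuclideanSpace ℝ (Fin q))
    (μ : ℝ) (u : L2Field U q) : Prop :=
  covOp P U V u =ᵐ[volume.restrict U] fun x => μ • u x

/-- `(lam k, φ k)`, `k = 0, 1, …`, is an enumeration of the eigenpairs of the covariance operator:
the eigenvalues are nonnegative and nonincreasing, the eigenfunctions are orthonormal, and no
nonzero eigenvalue or eigenfunction is left out. -/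
structure IsCovEigensystem (P : Measure Ω) {U : Set (EuclideanSpace ℝ (Fin d))}
    (V : EuclideanSpace ℝ (Fin d) → Ω → EuclideanSpace ℝ (Fin q))
    (lam : ℕ → ℝ) (φ : ℕ → L2Field U q) : Prop where
  nonneg : ∀ k, 0 ≤ lam k
  antitone : Antitone lam
  orthonormal : Orthonormal ℝ φ
  eigen : ∀ k, CovEigen P V (lam k) (φ k)
  exhaustive : ∀ (μ : ℝ) (u : L2Field U q), μ ≠ 0 → CovEigen P V μ u →
    u ∈ (Submodule.span ℝ (Set.range φ)).topologicalClosure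

/-- The coefficient `Y(ω) = lam^(-1/2) ∫_U (v(x, ω) - E[v](x))ᵀ φ(x) dx`. -/
def klCoeff {P : Measure Ω} {U : Set (EuclideanSpace ℝ (Fin d))}
    (v : RandomField P U q) (lam : ℝ) (φ : L2Field U q) (ω : Ω) : ℝ :=
  (Real.sqrt lam)⁻¹ * ∫ x in U, inner ℝ (v ω x - meanField v x) (φ x)

/-- The elementary tensor `φ ⊗ s`, i.e. `ω ↦ s(ω) φ`, in `L²_P(Ω; L²(U; ℝ^q))`. -/
def elemTensor {P : Measure Ω} {U : Set (EuclideanSpace ℝ (Fin d))}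
    (φ : L2Field U q) (s : Lp ℝ 2 P) : RandomField P U q :=
  (ContinuousLinearMap.toSpanSingleton ℝ φ).compLp s

/-- The Hilbert tensor product `H ⊗ L²_P(Ω)` as a closed subspace of `L²_P(Ω; L²(U; ℝ^q))`. -/
def tensorSubspace (P : Measure Ω) {U : Set (EuclideanSpace ℝ (Fin d))}
    (H : Submodule ℝ (L2Field U q)) : Submodule ℝ (RandomField P U q) :=
  (Submodule.span ℝ {w | ∃ φ ∈ H, ∃ s : Lp ℝ 2 P, w = elemTensor φ s}).topologicalClosure

instance (P : Measure Ω) {U : Set (EuclideanSpace ℝ (Fin d))}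
    (H : Submodule ℝ (L2Field U q)) : CompleteSpace (tensorSubspace P H) :=
  (Submodule.isClosed_topologicalClosure _).completeSpace_coe

/-- The error `‖w - P_{H ⊗ L²_P(Ω)} w‖` in `L²_P(Ω; L²(U; ℝ^q))`. -/
def projError {P : Measure Ω} {U : Set (EuclideanSpace ℝ (Fin d))}
    (w : RandomField P U q) (H : Submodule ℝ (L2Field U q)) : ℝ :=
  ‖w - (tensorSubspace P H).starProjection w‖

end

/-! Put E = L²(U; ℝ^q) and w = v - E[v]. The map a ↦ ⟨a, w⟩ from E to L²(Ω) (`coeffOp`) is a limit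
of finite-rank operators, hence compact, so C = `covCLM w`, its adjoint composed with itself, is
positive and compact. Passing to jointly measurable versions preserves norms between L²(Ω; L²(U))
and L²(U × Ω); this yields a version by approximation, and by Fubini the integral operator built
from any version agrees almost everywhere with C (`covOp_ae_eq`). What remains concerns one abstract
positive compact operator.

Eigenpairs arise by maximizing the quadratic form successively on orthogonal complements.
Exhaustiveness forces C to vanish on the complement of the closed span of the φ_k (`apply_eq_zero`),
so w takes its values in that span almost surely and Parseval gives Σ λ_k = ‖w‖². The squared error
of the partial sum over a finite index set s is ‖w‖² - Σ_{k∈s} λ_k, whence unconditional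
convergence; orthonormality of the coefficients is the identity ⟨C φ_k, φ_l⟩ = E[⟨φ_k, w⟩⟨φ_l, w⟩].

The squared projection error for H is ‖w‖² minus the trace of C over H (`projError_sq`), so
optimality is Ky Fan's maximum principle (`trace_le`). It reduces to a scalar inequality for the
weights c_k = ‖P_H φ_k‖² (`weighted_sum_le`), whose equality case identifies the optimal subspaces;
a spectral gap leaves only one (`span_eq_of_gap`). -/

/-! ### Existence of eigensystems of positive compact operators -/

section SpectralTheory

variable {E : Type*} [NormedAddCommGroup E] [InnerProductSpace ℝ E]

open Module.End in
/-- A positive compact operator attains its norm at an eigenvector. -/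
theorem ContinuousLinearMap.IsPositive.exists_eigenvector_norm [CompleteSpace E] [Nontrivial E] {T : E →L[ℝ] E}
    (hT : T.IsPositive) (hc : IsCompactOperator T) : ∃ x : E, ‖x‖ = 1 ∧ T x = ‖T‖ • x := by
  suffices h : ∃ x : E, x ≠ 0 ∧ T x = ‖T‖ • x by
    obtain ⟨x, hx, hTx⟩ := h
    refine ⟨‖x‖⁻¹ • x, by simp [norm_smul, hx], ?_⟩
    rw [map_smul, hTx, smul_comm]
  by_cases h0 : ‖T‖ = 0
  · obtain ⟨x, hx⟩ := exists_ne (0 : E)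
    exact ⟨x, hx, by simp [norm_eq_zero.1 h0]⟩
  rcases hc.hasEigenvalue_or_mem_resolventSet h0 with h | h
  · obtain ⟨x, hx⟩ := h.exists_hasEigenvector
    exact ⟨x, hx.2, hx.apply_eq_smul⟩
  -- By the Fredholm alternative, ‖T‖ would otherwise lie in the resolvent set, keeping the Rayleigh
  -- quotient below ‖T‖ - ε; but its supremum is ‖T‖.
  · obtain ⟨ε, hε, hle⟩ := T.rayleighQuotient_le_of_norm_mem_resolventSet (by simpa using h)
    have hnorm := T.norm_eq_iSup_rayleighQuotient hT.isSymmetric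
    have : ⨆ x, |T.rayleighQuotient x| ≤ ‖T‖ - ε := ciSup_le fun x => by
      rw [abs_of_nonneg]
      · exact hle x
      · exact div_nonneg (by simpa using! hT.inner_nonneg_left x) (by positivity)
    linarith

/-- A positive compact operator has, in every nonzero closed invariant subspace, an eigenvector
at which the quadratic form is maximal. -/
theorem ContinuousLinearMap.IsPositive.exists_eigenvector_isMax {T : E →L[ℝ] E}
    (hT : T.IsPositive) (hc : IsCompactOperator T) (K : Submodule ℝ E) [CompleteSpace K]
    (hK : K ≠ ⊥) (hinv : ∀ x ∈ K, T x ∈ K) :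
    ∃ x ∈ K, ∃ μ : ℝ, ‖x‖ = 1 ∧ T x = μ • x ∧ ∀ z ∈ K, inner ℝ (T z) z ≤ μ * ‖z‖ ^ 2 := by
  have : Nontrivial K := Submodule.nontrivial_iff_ne_bot.2 hK
  let S : K →L[ℝ] K := T.restrict hinv
  have hSc : IsCompactOperator S := hc.restrict' hinv
  have hS : S.IsPositive := by
    rw [ContinuousLinearMap.isPositive_iff']
    refine ⟨(ContinuousLinearMap.isSelfAdjoint_iff_isSymmetric).2
      (hT.isSymmetric.restrict_invariant hinv), fun x => ?_⟩
    simpa using! hT.inner_nonneg_left (x : E)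
  obtain ⟨x, hx, hSx⟩ := hS.exists_eigenvector_norm hSc
  refine ⟨x, x.2, ‖S‖, hx, congrArg Subtype.val hSx, fun z hz => ?_⟩
  calc inner ℝ (T z) z = inner ℝ (S ⟨z, hz⟩) ⟨z, hz⟩ := rfl
    _ ≤ ‖S ⟨z, hz⟩‖ * ‖(⟨z, hz⟩ : K)‖ := real_inner_le_norm _ _
    _ ≤ (‖S‖ * ‖(⟨z, hz⟩ : K)‖) * ‖(⟨z, hz⟩ : K)‖ := by gcongr; exact S.le_opNorm _
    _ = ‖S‖ * ‖z‖ ^ 2 := by simp only [Submodule.coe_norm]; ring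

/-- `(lam k, φ k)`, `k = 0, 1, …`, enumerates the eigenpairs of `T`: the eigenvalues are
nonnegative and nonincreasing, the eigenvectors are orthonormal, and their closed span contains
every eigenvector for a nonzero eigenvalue. -/
structure ContinuousLinearMap.IsEigensystem (T : E →L[ℝ] E) (lam : ℕ → ℝ) (φ : ℕ → E) :
    Prop where
  nonneg : ∀ k, 0 ≤ lam k
  antitone : Antitone lam
  orthonormal : Orthonormal ℝ φ
  eigen : ∀ k, T (φ k) = lam k • φ k
  exhaustive : ∀ (μ : ℝ) (u : E), μ ≠ 0 → T u = μ • u →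
    u ∈ (Submodule.span ℝ (Set.range φ)).topologicalClosure

/-- The orthogonal complement of a set of eigenvectors of a symmetric operator is invariant. -/
theorem ContinuousLinearMap.IsPositive.apply_mem_orthogonal_span {T : E →L[ℝ] E}
    (hT : T.IsPositive) {s : Set E} (hs : ∀ x ∈ s, ∃ μ : ℝ, T x = μ • x) {z : E}
    (hz : z ∈ (Submodule.span ℝ s)ᗮ) : T z ∈ (Submodule.span ℝ s)ᗮ := by
  rw [Submodule.mem_orthogonal] at hz ⊢
  intro u hu
  rw [← hT.inner_left_eq_inner_right]
  refine hz _ ?_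
  induction hu using Submodule.span_induction with
  | mem x hx =>
    obtain ⟨μ, hμ⟩ := hs x hx
    rw [hμ]
    exact Submodule.smul_mem _ _ (Submodule.subset_span hx)
  | zero => simp
  | add x y _ _ hx hy => rw [map_add]; exact add_mem hx hy
  | smul a x _ hx => rw [map_smul]; exact Submodule.smul_mem _ _ hx

/-- The eigenvalues of a compact operator along an orthonormal sequence are not bounded away
from zero. -/
theorem IsCompactOperator.exists_eigenvalue_lt {T : E →L[ℝ] E} (hc : IsCompactOperator T)
    {lam : ℕ → ℝ} {φ : ℕ → E} (hφ : Orthonormal ℝ φ) (hT : ∀ k, T (φ k) = lam k • φ k)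
    {μ : ℝ} (hμ : 0 < μ) : ∃ n, lam n < μ := by
  by_contra! hle
  have hpos : ∀ n, 0 < lam n := fun n => hμ.trans_le (hle n)
  obtain ⟨K, hK, hKT⟩ := hc.image_closedBall_subset_compact (f := T.toLinearMap) 1
  have hmem : ∀ n, T (φ n) ∈ K := fun n =>
    hKT ⟨φ n, by simp [hφ.1 n], rfl⟩
  obtain ⟨y, -, s, hs, hy⟩ := hK.tendsto_subseq hmem
  have hnorm : ∀ n, ‖T (φ n)‖ = lam n := fun n => by
    rw [hT, norm_smul, hφ.1 n, mul_one, Real.norm_of_nonneg (hpos n).le]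
  -- The limit y is tested against itself. Bessel makes the orthonormal sequence weakly null and the
  -- eigenvalues are bounded by ‖T‖, so y = 0, which contradicts ‖T φ_n‖ = lam n ≥ μ.
  have hlim : Tendsto (fun n => inner ℝ (T (φ (s n))) y) atTop (𝓝 (inner ℝ y y)) :=
    hy.inner tendsto_const_nhds
  have hbessel : Tendsto (fun n => inner ℝ (φ (s n)) y) atTop (𝓝 0) := by
    have h := (hφ.inner_products_summable y).tendsto_atTop_zero.comp hs.tendsto_atTop
    rw [tendsto_zero_iff_norm_tendsto_zero]
    simpa [Real.sqrt_sq_eq_abs] using! h.sqrt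
  have hzero : Tendsto (fun n => inner ℝ (T (φ (s n))) y) atTop (𝓝 0) := by
    have hb : IsBoundedUnder (· ≤ ·) atTop fun n => ‖lam (s n)‖ := by
      refine isBoundedUnder_of ⟨‖T‖, fun n => ?_⟩
      rw [Real.norm_of_nonneg (hpos _).le, ← hnorm]
      simpa [hφ.1] using T.le_opNorm (φ (s n))
    simpa [hT, inner_smul_left] using hb.smul_tendsto_zero hbessel
  have hy0 : y = 0 := inner_self_eq_zero.1 (tendsto_nhds_unique hlim hzero)
  have h0 : Tendsto (fun n => lam (s n)) atTop (𝓝 0) := by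
    simpa [hnorm, hy0, Function.comp_def] using hy.norm
  exact absurd (ge_of_tendsto' h0 fun n => hle (s n)) hμ.not_ge

open Classical in
/-- Every positive compact operator on an infinite-dimensional Hilbert space has an eigensystem. -/
theorem ContinuousLinearMap.IsPositive.exists_isEigensystem [CompleteSpace E] {T : E →L[ℝ] E}
    (hT : T.IsPositive) (hc : IsCompactOperator T) (hE : ¬ FiniteDimensional ℝ E) :
    ∃ (lam : ℕ → ℝ) (φ : ℕ → E), T.IsEigensystem lam φ := by
  -- Greedy choice: a unit eigenvector maximizing the quadratic form on the complement of those
  -- already chosen. For an `s` not made of eigenvectors the choice is arbitrary and never used.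
  have step : ∀ s : Finset E, ∃ p : ℝ × E, (∀ x ∈ s, ∃ μ : ℝ, T x = μ • x) →
      p.2 ∈ (Submodule.span ℝ (s : Set E))ᗮ ∧ ‖p.2‖ = 1 ∧ T p.2 = p.1 • p.2 ∧
        ∀ z ∈ (Submodule.span ℝ (s : Set E))ᗮ, inner ℝ (T z) z ≤ p.1 * ‖z‖ ^ 2 := by
    intro s
    by_cases hs : ∀ x ∈ s, ∃ μ : ℝ, T x = μ • x
    · have hne : (Submodule.span ℝ (s : Set E))ᗮ ≠ ⊥ := fun h => hE <| by
        have : FiniteDimensional ℝ (Submodule.span ℝ (s : Set E)) :=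
          FiniteDimensional.span_finset ℝ s
        rw [Submodule.orthogonal_eq_bot_iff] at h
        exact Module.finite_def.2 (h ▸ (Submodule.fg_span s.finite_toSet))
      obtain ⟨x, hx, μ, h1, h2, h3⟩ := hT.exists_eigenvector_isMax hc _ hne
        fun z hz => hT.apply_mem_orthogonal_span hs hz
      exact ⟨(μ, x), fun _ => ⟨hx, h1, h2, h3⟩⟩
    · exact ⟨0, fun h => absurd h hs⟩
  choose next hnext using step
  let S : ℕ → Finset E := fun n => Nat.rec ∅ (fun _ s => insert (next s).2 s) n
  have hS : ∀ n, S (n + 1) = insert (next (S n)).2 (S n) := fun n => rfl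
  have hSeig : ∀ n, ∀ x ∈ S n, ∃ μ : ℝ, T x = μ • x := by
    intro n
    induction n with
    | zero => simp [S]
    | succ n ih =>
      intro x hx
      rcases Finset.mem_insert.1 (hS n ▸ hx) with rfl | hx
      · exact ⟨_, (hnext _ ih).2.2.1⟩
      · exact ih x hx
  let φ : ℕ → E := fun n => (next (S n)).2
  let lam : ℕ → ℝ := fun n => (next (S n)).1
  have hspec := fun n => hnext (S n) (hSeig n)
  have hmono : Monotone S := monotone_nat_of_le_succ fun n => hS n ▸ Finset.subset_insert _ _
  have hmemS : ∀ {m n}, m < n → φ m ∈ S n := fun {m n} h =>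
    hmono (Nat.succ_le_of_lt h) (by rw [Nat.succ_eq_add_one, hS]; exact Finset.mem_insert_self _ _)
  have hquad : ∀ n, inner ℝ (T (φ n)) (φ n) = lam n := fun n => by
    rw [(hspec n).2.2.1, inner_smul_left, real_inner_self_eq_norm_sq, (hspec n).2.1]
    simp [lam]
  have hon : Orthonormal ℝ φ := by
    refine ⟨fun n => (hspec n).2.1, fun m n hmn => ?_⟩
    rcases hmn.lt_or_gt with h | h
    · exact (hspec n).1 _ (Submodule.subset_span (hmemS h))
    · rw [real_inner_comm]
      exact (hspec m).1 _ (Submodule.subset_span (hmemS h))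
  have heig : ∀ k, T (φ k) = lam k • φ k := fun k => (hspec k).2.2.1
  refine ⟨lam, φ, fun k => ?_, antitone_nat_of_succ_le fun n => ?_, hon, heig, ?_⟩
  · rw [← hquad]; exact hT.inner_nonneg_left _
  · have h : inner ℝ (T (φ (n + 1))) (φ (n + 1)) ≤ lam n * ‖φ (n + 1)‖ ^ 2 := (hspec n).2.2.2 _
      (Submodule.orthogonal_le (Submodule.span_mono (Finset.coe_subset.2 (hmono n.le_succ)))
        (hspec (n + 1)).1)
    simpa [hon.1] using (hquad (n + 1)).ge.trans h
  · intro μ u hμ hu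
    let V := (Submodule.span ℝ (Set.range φ)).topologicalClosure
    have : CompleteSpace V := (Submodule.isClosed_topologicalClosure _).completeSpace_coe
    have hVo : Vᗮ = (Submodule.span ℝ (Set.range φ))ᗮ := Submodule.orthogonal_closure _
    have hinvo : ∀ z ∈ Vᗮ, T z ∈ Vᗮ := fun z hz => by
      rw [hVo] at hz ⊢
      exact hT.apply_mem_orthogonal_span (by rintro _ ⟨k, rfl⟩; exact ⟨_, heig k⟩) hz
    have hinv : ∀ z ∈ V, T z ∈ V := fun z hz => by
      rw [← V.orthogonal_orthogonal, Submodule.mem_orthogonal]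
      intro y hy
      rw [← hT.inner_left_eq_inner_right]
      exact (V.mem_orthogonal' _).1 (hinvo y hy) z hz
    -- The component of u orthogonal to V is again a μ-eigenvector, because T x - μ x lies in both V
    -- and its complement. If x ≠ 0, maximality at every stage gives μ ≤ lam n for all n, against
    -- `exists_eigenvalue_lt`.
    let x := u - V.starProjection u
    have hx : x ∈ Vᗮ := V.sub_starProjection_mem_orthogonal u
    have hTx : T x = μ • x := by
      have h1 : T x - μ • x ∈ Vᗮ := sub_mem (hinvo x hx) (Submodule.smul_mem _ _ hx)
      have h2 : T x - μ • x ∈ V := by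
        have : T x - μ • x = μ • V.starProjection u - T (V.starProjection u) := by
          simp only [x, map_sub, hu, smul_sub]; abel
        rw [this]
        exact sub_mem (Submodule.smul_mem _ _ (V.starProjection_apply_mem u))
          (hinv _ (V.starProjection_apply_mem u))
      exact sub_eq_zero.1 (inner_self_eq_zero.1 (h1 _ h2))
    by_contra hne
    have hx0 : 0 < ‖x‖ ^ 2 := by
      have : x ≠ 0 := fun h => hne <| by
        rw [sub_eq_zero.1 h]; exact V.starProjection_apply_mem u
      positivity
    have hμx : inner ℝ (T x) x = μ * ‖x‖ ^ 2 := by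
      rw [hTx, inner_smul_left, real_inner_self_eq_norm_sq]; rfl
    have hμ0 : 0 < μ := by
      have := hT.inner_nonneg_left x
      rw [hμx] at this
      exact lt_of_le_of_ne (nonneg_of_mul_nonneg_left this hx0) hμ.symm
    obtain ⟨n, hn⟩ := hc.exists_eigenvalue_lt hon heig hμ0
    have h := (hspec n).2.2.2 x <| by
      refine Submodule.orthogonal_le (Submodule.span_le.2 ?_) hx
      intro y hy
      have : ∀ n, ∀ y ∈ S n, y ∈ Set.range φ := fun n => by
        induction n with
        | zero => simp [S]
        | succ n ih =>
          intro y hy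
          rcases Finset.mem_insert.1 (hS n ▸ hy) with rfl | hy
          · exact ⟨n, rfl⟩
          · exact ih y hy
      exact Submodule.le_topologicalClosure _ (Submodule.subset_span (this n y hy))
    rw [hμx] at h
    exact absurd (le_of_mul_le_mul_right h hx0) hn.not_ge

/-! ### Expansions along an eigensystem -/

/-- The closed linear span of a sequence of vectors. -/
abbrev closedSpan (φ : ℕ → E) : Submodule ℝ E :=
  (Submodule.span ℝ (Set.range φ)).topologicalClosure

theorem subset_closedSpan (φ : ℕ → E) (k : ℕ) : φ k ∈ closedSpan φ :=
  Submodule.le_topologicalClosure _ (Submodule.subset_span ⟨k, rfl⟩)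

/-- The expansion of the orthogonal projection onto the closed span of an orthonormal sequence. -/
theorem Orthonormal.hasSum_starProjection_closedSpan [CompleteSpace E] {φ : ℕ → E}
    (hφ : Orthonormal ℝ φ) (x : E) :
    HasSum (fun k => inner ℝ (φ k) x • φ k) ((closedSpan φ).starProjection x) := by
  let v : ℕ → closedSpan φ := fun k => ⟨φ k, subset_closedSpan φ k⟩
  have hv : Orthonormal ℝ v := ⟨fun k => hφ.1 k, fun i j hij => hφ.2 hij⟩
  have hsp : (Submodule.span ℝ (Set.range v))ᗮ = ⊥ := by
    rw [Submodule.eq_bot_iff]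
    intro y hy
    have : (y : E) ∈ (closedSpan φ)ᗮ := by
      rw [Submodule.orthogonal_closure, Submodule.mem_orthogonal]
      intro u hu
      induction hu using Submodule.span_induction with
      | mem x hx =>
        obtain ⟨k, rfl⟩ := hx
        exact hy (v k) (Submodule.subset_span ⟨k, rfl⟩)
      | zero => simp
      | add a b _ _ ha hb => rw [inner_add_left, ha, hb, add_zero]
      | smul c a _ ha => rw [inner_smul_left, ha, mul_zero]
    exact Subtype.ext (inner_self_eq_zero.1 (this y y.2))
  let b := HilbertBasis.mkOfOrthogonalEqBot hv hsp
  have h := (b.hasSum_orthogonalProjectionOnto x).mapL (closedSpan φ).subtypeL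
  have hb : ⇑b = v := HilbertBasis.coe_mkOfOrthogonalEqBot hv hsp
  simpa [hb, v] using! h

/-- Parseval's identity in the closed span of an orthonormal sequence. -/
theorem Orthonormal.hasSum_inner_sq [CompleteSpace E] {φ : ℕ → E} (hφ : Orthonormal ℝ φ)
    (x : E) :
    HasSum (fun k => inner ℝ (φ k) x ^ 2) (‖(closedSpan φ).starProjection x‖ ^ 2) := by
  have h := (hφ.hasSum_starProjection_closedSpan x).mapL (innerSL ℝ x)
  have hn : inner ℝ ((closedSpan φ).starProjection x) x = ‖(closedSpan φ).starProjection x‖ ^ 2 :=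
    (closedSpan φ).re_inner_starProjection_eq_normSq x
  simp only [innerSL_apply_apply, real_inner_comm _ x, hn] at h
  simpa only [real_inner_smul_left, ← sq] using h

/-- A positive compact operator vanishes on the orthogonal complement of an eigensystem. -/
theorem ContinuousLinearMap.IsEigensystem.apply_eq_zero [CompleteSpace E] {T : E →L[ℝ] E}
    {lam : ℕ → ℝ} {φ : ℕ → E} (h : T.IsEigensystem lam φ) (hT : T.IsPositive)
    (hc : IsCompactOperator T) {x : E} (hx : x ∈ (closedSpan φ)ᗮ) : T x = 0 := by
  by_cases hK : (closedSpan φ)ᗮ = ⊥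
  · rw [hK, Submodule.mem_bot] at hx
    simp [hx]
  have hinv : ∀ z ∈ (closedSpan φ)ᗮ, T z ∈ (closedSpan φ)ᗮ := fun z hz => by
    rw [Submodule.orthogonal_closure] at hz ⊢
    exact hT.apply_mem_orthogonal_span (by rintro _ ⟨k, rfl⟩; exact ⟨_, h.eigen k⟩) hz
  obtain ⟨y, hy, μ, hy1, hμ, hmax⟩ := hT.exists_eigenvector_isMax hc _ hK hinv
  -- A nonzero maximal eigenvalue on the complement would have an eigenvector that exhaustiveness
  -- places in the closed span as well.
  have hμ0 : μ = 0 := by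
    by_contra hne
    have := inner_self_eq_zero.1 (hy y (h.exhaustive μ y hne hμ))
    simp [this] at hy1
  have hnonpos : ∀ z ∈ (closedSpan φ)ᗮ, inner ℝ (T z) z = 0 := fun z hz =>
    le_antisymm (by simpa [hμ0] using hmax z hz) (hT.inner_nonneg_left z)
  have hTx := hinv x hx
  -- Polarization: the form vanishes at x, T x and x + T x, and by symmetry both cross terms equal
  -- ‖T x‖².
  have h1 := hnonpos (x + T x) (add_mem hx hTx)
  have h2 := hnonpos x hx
  have h3 := hnonpos _ hTx
  have h4 := hT.inner_left_eq_inner_right (T x) x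
  simp only [map_add, inner_add_left, inner_add_right, h2, h3, h4, zero_add, add_zero] at h1
  exact inner_self_eq_zero.1 (add_self_eq_zero.1 h1)

/-- The spectral expansion of a positive compact operator. -/
theorem ContinuousLinearMap.IsEigensystem.hasSum_apply [CompleteSpace E] {T : E →L[ℝ] E}
    {lam : ℕ → ℝ} {φ : ℕ → E} (h : T.IsEigensystem lam φ) (hT : T.IsPositive)
    (hc : IsCompactOperator T) (x : E) :
    HasSum (fun k => (lam k * inner ℝ (φ k) x) • φ k) (T x) := by
  have h1 := (h.orthonormal.hasSum_starProjection_closedSpan x).mapL T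
  have h2 : T ((closedSpan φ).starProjection x) = T x := by
    have := h.apply_eq_zero hT hc ((closedSpan φ).sub_starProjection_mem_orthogonal x)
    rw [map_sub, sub_eq_zero] at this
    exact this.symm
  rw [h2] at h1
  convert h1 using 2 with k
  rw [map_smul, h.eigen, smul_smul, mul_comm]

/-- The spectral expansion of the quadratic form of a positive compact operator. -/
theorem ContinuousLinearMap.IsEigensystem.hasSum_inner_apply [CompleteSpace E] {T : E →L[ℝ] E}
    {lam : ℕ → ℝ} {φ : ℕ → E} (h : T.IsEigensystem lam φ) (hT : T.IsPositive)
    (hc : IsCompactOperator T) (x : E) :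
    HasSum (fun k => lam k * inner ℝ (φ k) x ^ 2) (inner ℝ (T x) x) := by
  have h1 := (h.hasSum_apply hT hc x).mapL (innerSL ℝ x)
  simp only [innerSL_apply_apply, real_inner_comm _ x] at h1
  simpa only [real_inner_smul_left, mul_assoc, ← sq] using h1

/-! ### Ky Fan's maximum principle with its equality case -/

/-- Among weights in `[0, 1]` of total mass at most `N + 1`, the weighted sum of a nonincreasing
sequence is largest for the first `N + 1` terms, with a description of the case of equality. -/
theorem Antitone.weighted_sum_le {lam c : ℕ → ℝ} (hlam : Antitone lam) (N : ℕ)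
    (hN : 0 ≤ lam N) (hc0 : ∀ k, 0 ≤ c k) (hc1 : ∀ k, c k ≤ 1) {C L : ℝ} (hC : HasSum c C)
    (hCN : C ≤ N + 1) (hL : HasSum (fun k => lam k * c k) L) :
    L ≤ ∑ k ∈ Finset.range (N + 1), lam k ∧
      (L = ∑ k ∈ Finset.range (N + 1), lam k →
        (∀ k, lam N < lam k → c k = 1) ∧ (∀ k, lam k < lam N → c k = 0) ∧
          (0 < lam N → C = N + 1)) := by
  let e : ℕ → ℝ := fun k => if k ∈ Finset.range (N + 1) then 1 else 0
  let d : ℕ → ℝ := fun k => (lam k - lam N) * (e k - c k)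
  -- Both factors of `d k` change sign at the threshold `lam N`, the last retained eigenvalue. The
  -- head sum minus L is Σ d k plus lam N times the missing mass N + 1 - C, both nonnegative;
  -- equality makes each of them vanish.
  have hd0 : ∀ k, 0 ≤ d k := by
    intro k
    by_cases hk : k ∈ Finset.range (N + 1)
    · have : lam N ≤ lam k := hlam (by simpa [Nat.lt_succ_iff] using hk)
      simp only [d, e, if_pos hk]
      exact mul_nonneg (by linarith) (by linarith [hc1 k])
    · have : lam k ≤ lam N := hlam (by simp at hk; omega)
      simp only [d, e, if_neg hk]
      exact mul_nonneg_of_nonpos_of_nonpos (by linarith) (by linarith [hc0 k])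
  have he : HasSum e (N + 1) := by
    have : HasSum e (∑ k ∈ Finset.range (N + 1), e k) :=
      hasSum_sum_of_ne_finset_zero fun k hk => if_neg hk
    rwa [Finset.sum_congr rfl fun k hk => if_pos hk, Finset.sum_const, Finset.card_range,
      nsmul_one, Nat.cast_succ] at this
  have hle : HasSum (fun k => lam k * e k) (∑ k ∈ Finset.range (N + 1), lam k) := by
    have : HasSum (fun k => lam k * e k) (∑ k ∈ Finset.range (N + 1), lam k * e k) :=
      hasSum_sum_of_ne_finset_zero fun k hk => by simp only [e, if_neg hk, mul_zero]
    rwa [Finset.sum_congr rfl fun k hk => by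
      simp only [e, if_pos hk]; exact mul_one (lam k)] at this
  have hd : HasSum d ((∑ k ∈ Finset.range (N + 1), lam k) - L - lam N * (N + 1 - C)) := by
    refine ((hle.sub hL).sub ((he.sub hC).mul_left (lam N))).congr_fun fun k => ?_
    simp only [d]; ring
  have hd' := hd.nonneg hd0
  have hmC : 0 ≤ lam N * (N + 1 - C) := mul_nonneg hN (by linarith)
  refine ⟨by linarith, fun heq => ?_⟩
  have hz : lam N * (N + 1 - C) = 0 := by linarith
  have hd0' : ∀ k, d k = 0 := by
    have : HasSum d 0 := by convert hd using 1; linarith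
    exact fun k => congrFun ((hasSum_zero_iff_of_nonneg hd0).1 this) k
  refine ⟨fun k hk => ?_, fun k hk => ?_, fun hpos => ?_⟩
  · have hkN : k ∈ Finset.range (N + 1) := by
      by_contra hk'
      exact absurd (hlam (by simp at hk'; omega : N ≤ k)) hk.not_ge
    have := (mul_eq_zero.1 (hd0' k)).resolve_left (by linarith)
    simp only [e, if_pos hkN] at this
    linarith
  · have hkN : k ∉ Finset.range (N + 1) := fun hk' =>
      absurd (hlam (by simp at hk'; omega : k ≤ N)) hk.not_ge
    have := (mul_eq_zero.1 (hd0' k)).resolve_left (by linarith)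
    simp only [e, if_neg hkN] at this
    linarith
  · have := (mul_eq_zero.1 hz).resolve_left hpos.ne'
    linarith

variable {T : E →L[ℝ] E} {lam : ℕ → ℝ} {φ : ℕ → E}

theorem OrthonormalBasis.orthonormal_coe {ι : Type*} [Fintype ι] {H : Submodule ℝ E}
    (b : OrthonormalBasis ι ℝ H) : Orthonormal ℝ fun i => (b i : E) :=
  ⟨fun i => b.orthonormal.1 i, fun _ _ hij => b.orthonormal.2 hij⟩

theorem OrthonormalBasis.span_range_coe {ι : Type*} [Fintype ι] {H : Submodule ℝ E}
    (b : OrthonormalBasis ι ℝ H) : Submodule.span ℝ (Set.range fun i => (b i : E)) = H := by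
  have := congrArg (Submodule.map H.subtype) b.toBasis.span_eq
  rw [Submodule.map_span, Submodule.map_top, Submodule.range_subtype, ← Set.range_comp] at this
  simpa [Function.comp_def] using! this

theorem image_Iio_eq_range {α : Type*} (φ : ℕ → α) (M : ℕ) :
    φ '' Set.Iio M = Set.range fun i : Fin M => φ i := by
  ext x
  constructor
  · rintro ⟨k, hk, rfl⟩
    exact ⟨⟨k, hk⟩, rfl⟩
  · rintro ⟨i, rfl⟩
    exact ⟨i, i.2, rfl⟩

variable [CompleteSpace E]

/-- Ky Fan's maximum principle: among the orthonormal families with `M` members, the first `M`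
eigenvectors maximize the trace of a positive compact operator. In the case of equality, the span
of the family has an orthonormal basis of eigenvectors for the first `M` eigenvalues. -/
theorem ContinuousLinearMap.IsEigensystem.trace_le (h : T.IsEigensystem lam φ)
    (hT : T.IsPositive) (hc : IsCompactOperator T) {M : ℕ} {H : Submodule ℝ E}
    (b : OrthonormalBasis (Fin M) ℝ H) :
    ∑ i, inner ℝ (T (b i)) (b i : E) ≤ ∑ k ∈ Finset.range M, lam k ∧
      (∑ i, inner ℝ (T (b i)) (b i : E) = ∑ k ∈ Finset.range M, lam k →
        ∃ ψ : Fin M → E, Orthonormal ℝ ψ ∧ (∀ i : Fin M, T (ψ i) = lam i • ψ i) ∧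
          H = Submodule.span ℝ (Set.range ψ)) := by
  have hfin : FiniteDimensional ℝ H := b.toBasis.finiteDimensional_of_finite
  rcases M with _ | N
  · exact ⟨by simp, fun _ => ⟨fun i => b i, b.orthonormal_coe, fun i => i.elim0, b.span_range_coe.symm⟩⟩
  -- The weight c k is the squared length of the projection of φ k onto H, hence at most 1. Summing
  -- over k first gives total mass at most N + 1, and the trace is Σ lam k * c k.
  let c : ℕ → ℝ := fun k => ∑ i, inner ℝ (φ k) (b i : E) ^ 2
  have hcP : ∀ k, c k = ‖H.starProjection (φ k)‖ ^ 2 := fun k => by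
    have := b.sum_sq_norm_inner_right (H.orthogonalProjectionOnto (φ k))
    rw [Submodule.starProjection_apply, Submodule.norm_coe, ← this]
    refine Finset.sum_congr rfl fun i _ => ?_
    rw [Submodule.inner_orthogonalProjectionOnto_eq_of_mem_left, real_inner_comm, Real.norm_eq_abs,
      sq_abs]
  have hc1 : ∀ k, c k ≤ 1 := fun k => by
    rw [hcP]
    have := H.norm_starProjection_apply_le (φ k)
    rw [h.orthonormal.1] at this
    exact pow_le_one₀ (norm_nonneg _) this
  let C : ℝ := ∑ i, ‖(closedSpan φ).starProjection (b i : E)‖ ^ 2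
  have hC : HasSum c C := hasSum_sum fun i _ => h.orthonormal.hasSum_inner_sq (b i : E)
  have hle1 : ∀ i, ‖(closedSpan φ).starProjection (b i : E)‖ ^ 2 ≤ 1 := fun i => by
    have := (closedSpan φ).norm_starProjection_apply_le (b i : E)
    rw [b.orthonormal_coe.1] at this
    exact pow_le_one₀ (norm_nonneg _) this
  have hCN : C ≤ N + 1 := by
    have := Finset.sum_le_sum fun i (_ : i ∈ Finset.univ) => hle1 i
    simpa using this
  have hL : HasSum (fun k => lam k * c k) (∑ i, inner ℝ (T (b i)) (b i : E)) := by
    simp only [c, Finset.mul_sum]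
    exact hasSum_sum fun i _ => h.hasSum_inner_apply hT hc (b i : E)
  obtain ⟨h1, h2⟩ := h.antitone.weighted_sum_le N (h.nonneg N)
    (fun k => Finset.sum_nonneg fun i _ => sq_nonneg _) hc1 hC hCN hL
  refine ⟨h1, fun heq => ?_⟩
  -- In the equality case, eigenvectors above the threshold lie in H, those below it are orthogonal
  -- to H, and H lies in the closed span when the threshold is positive.
  obtain ⟨hgt, hlt, hpos⟩ := h2 heq
  have hmem : ∀ k, lam N < lam k → φ k ∈ H := fun k hk => by
    rw [H.mem_iff_norm_starProjection, h.orthonormal.1]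
    exact (pow_eq_one_iff_of_nonneg (norm_nonneg _) two_ne_zero).1 ((hcP k).symm.trans (hgt k hk))
  have hperp : ∀ k, lam k < lam N → ∀ y ∈ H, inner ℝ (φ k) y = 0 := fun k hk y hy => by
    have h0 : H.starProjection (φ k) = 0 := by
      have := (hcP k).symm.trans (hlt k hk)
      rwa [sq_eq_zero_iff, norm_eq_zero] at this
    rw [← Submodule.starProjection_eq_self_iff.2 hy,
      ← Submodule.inner_starProjection_left_eq_right, h0, inner_zero_left]
  have hsub : 0 < lam N → H ≤ closedSpan φ := fun hp => by
    rw [← b.span_range_coe, Submodule.span_le]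
    rintro _ ⟨i, rfl⟩
    have hsum : ∑ i, (1 - ‖(closedSpan φ).starProjection (b i : E)‖ ^ 2) = 0 := by
      rw [Finset.sum_sub_distrib]
      simpa [C, sub_eq_zero] using (hpos hp).symm
    have := (Finset.sum_eq_zero_iff_of_nonneg fun i _ => sub_nonneg.2 (hle1 i)).1 hsum i
      (Finset.mem_univ i)
    rw [SetLike.mem_coe, Submodule.mem_iff_norm_starProjection, b.orthonormal_coe.1]
    exact (pow_eq_one_iff_of_nonneg (norm_nonneg _) two_ne_zero).1 (sub_eq_zero.1 this).symm
  let s : Set (Fin (N + 1)) := {i | lam N < lam i}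
  -- The projection only serves to produce elements of H; on `s` it fixes φ i, and the other values
  -- are discarded when the family is extended to an orthonormal basis.
  let v : Fin (N + 1) → H := fun i => H.orthogonalProjectionOnto (φ i)
  have hv : ∀ i ∈ s, (v i : E) = φ i := fun i hi =>
    Submodule.starProjection_eq_self_iff.2 (hmem i hi)
  have hvon : Orthonormal ℝ (s.domRestrict v) := by
    refine ⟨fun i => ?_, fun i j hij => ?_⟩
    · change ‖(v i : E)‖ = 1
      rw [hv i i.2, h.orthonormal.1]
    · change inner ℝ (v i : E) (v j : E) = 0
      rw [hv i i.2, hv j j.2]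
      exact h.orthonormal.2 fun hij' => hij (Subtype.ext (Fin.ext hij'))
  obtain ⟨ψ, hψ⟩ := hvon.exists_orthonormalBasis_extension_of_card_eq
    (by rw [Module.finrank_eq_card_basis b.toBasis])
  have hψφ : ∀ i ∈ s, (ψ i : E) = φ i := fun i hi => by rw [hψ i hi, hv i hi]
  refine ⟨fun i => ψ i, ψ.orthonormal_coe, fun i => ?_, ψ.span_range_coe.symm⟩
  by_cases hi : i ∈ s
  · simp only [hψφ i hi, h.eigen]
  have hlami : lam i = lam N :=
    le_antisymm (not_lt.1 hi) (h.antitone (Nat.lt_succ_iff.1 i.2))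
  -- A basis vector outside `s` has nonzero coefficients only along eigenvectors for the eigenvalue
  -- `lam N`, so T acts on it as `lam N` times the projection onto the closed span.
  have hterm : ∀ k, lam k * inner ℝ (φ k) (ψ i : E) = lam N * inner ℝ (φ k) (ψ i : E) := by
    intro k
    rcases lt_trichotomy (lam k) (lam N) with hk | hk | hk
    · rw [hperp k hk _ (ψ i).2, mul_zero, mul_zero]
    · rw [hk]
    · have hkN : k < N + 1 := by
        by_contra hk'
        exact absurd (h.antitone (by omega : N ≤ k)) hk.not_ge
      have hks : (⟨k, hkN⟩ : Fin (N + 1)) ∈ s := hk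
      have : inner ℝ (φ k) (ψ i : E) = 0 := by
        have h0 := ψ.orthonormal_coe.2 (i := ⟨k, hkN⟩) (j := i) (fun e => hi (e ▸ hks))
        simpa only [hψφ _ hks] using h0
      rw [this, mul_zero, mul_zero]
  have hTψ := h.hasSum_apply hT hc (ψ i : E)
  simp only [hterm, mul_smul] at hTψ
  have hTψ' := (h.orthonormal.hasSum_starProjection_closedSpan (ψ i : E)).const_smul (lam N)
  rw [hTψ.unique hTψ', hlami]
  rcases (h.nonneg N).eq_or_lt with h0 | h0
  · simp [← h0]
  · rw [Submodule.starProjection_eq_self_iff.2 (hsub h0 (ψ i).2)]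

/-- If the `M`-th eigenvalue is smaller than the preceding ones, then the first `M` eigenvectors
span the same space as every orthonormal family of eigenvectors for the same eigenvalues. -/
theorem ContinuousLinearMap.IsEigensystem.span_eq_of_gap (h : T.IsEigensystem lam φ)
    (hT : T.IsPositive) {M : ℕ} (hgap : ∀ i < M, lam M < lam i) {ψ : Fin M → E}
    (hψ : Orthonormal ℝ ψ) (hTψ : ∀ i : Fin M, T (ψ i) = lam i • ψ i) :
    Submodule.span ℝ (Set.range ψ) = Submodule.span ℝ (φ '' Set.Iio M) := by
  have hφM : Orthonormal ℝ fun i : Fin M => φ i :=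
    h.orthonormal.comp _ Fin.val_injective
  have hfin : FiniteDimensional ℝ (Submodule.span ℝ (φ '' Set.Iio M)) := by
    rw [image_Iio_eq_range]; exact FiniteDimensional.span_of_finite ℝ (Set.finite_range _)
  refine Submodule.eq_of_le_of_finrank_eq (Submodule.span_le.2 ?_) ?_
  · rintro _ ⟨i, rfl⟩
    have hi := hgap i i.2
    have hmem := h.exhaustive (lam i) (ψ i) ((h.nonneg M).trans_lt hi).ne' (hTψ i)
    have hsum := h.orthonormal.hasSum_starProjection_closedSpan (ψ i)
    rw [Submodule.starProjection_eq_self_iff.2 hmem] at hsum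
    -- The gap separates lam k from lam i for k ≥ M, and eigenvectors of a symmetric operator for
    -- distinct eigenvalues are orthogonal.
    have hzero : ∀ k ∉ Finset.range M, inner ℝ (φ k) (ψ i) • φ k = 0 := fun k hk => by
      have hk' : lam k ≤ lam M := h.antitone (by simpa using hk)
      have e := hT.inner_left_eq_inner_right (φ k) (ψ i)
      rw [h.eigen, hTψ, real_inner_smul_left, real_inner_smul_right] at e
      have : (lam k - lam i) * inner ℝ (φ k) (ψ i) = 0 := by linarith
      rw [(mul_eq_zero.1 this).resolve_left (by linarith), zero_smul]
    rw [hsum.unique (hasSum_sum_of_ne_finset_zero hzero)]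
    exact Submodule.sum_mem _ fun k hk => Submodule.smul_mem _ _
      (Submodule.subset_span ⟨k, by simpa using hk, rfl⟩)
  · rw [image_Iio_eq_range, finrank_span_eq_card hψ.linearIndependent,
      finrank_span_eq_card hφM.linearIndependent]

end SpectralTheory

/-! ### Covariance operators of square-integrable random elements -/

section RandomElements

variable {E : Type*} [NormedAddCommGroup E] [InnerProductSpace ℝ E]
  {Ω : Type*} [MeasurableSpace Ω] {P : Measure Ω}

/-- The coefficient operator `a ↦ ⟨a, w(·)⟩` of `w ∈ L²(Ω; E)`, as a continuous bilinear map. -/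
noncomputable def coeffOpL (E : Type*) [NormedAddCommGroup E] [InnerProductSpace ℝ E]
    (P : Measure Ω) : Lp E 2 P →L[ℝ] E →L[ℝ] Lp ℝ 2 P :=
  (ContinuousLinearMap.compLpL₂ 2 P ((innerₗ E).mkContinuous₂ 1 fun x y => by
    simpa using abs_real_inner_le_norm x y)).flip

/-- The coefficient operator `a ↦ ⟨a, w(·)⟩` of `w ∈ L²(Ω; E)`. -/
noncomputable def coeffOp (w : Lp E 2 P) : E →L[ℝ] Lp ℝ 2 P := coeffOpL E P w

theorem coeffOp_ae_eq (w : Lp E 2 P) (a : E) :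
    coeffOp w a =ᵐ[P] fun ω => inner ℝ a (w ω) :=
  ContinuousLinearMap.coeFn_compLp _ w

/-- An indicator times a constant vector gives a rank-one operator. Compact operators are closed
under sums and norm limits, and the coefficient operator depends continuously on w, so density of
simple functions suffices. -/
theorem isCompactOperator_coeffOp (w : Lp E 2 P) : IsCompactOperator (coeffOp w) := by
  induction w using Lp.induction (p := 2) ENNReal.ofNat_ne_top with
  | @indicatorConst c t hs hμs =>
    have hrank : coeffOp (Lp.simpleFunc.indicatorConst 2 hs hμs.ne c : Lp E 2 P) =
        (ContinuousLinearMap.toSpanSingleton ℝ (indicatorConstLp 2 hs hμs.ne (1 : ℝ))).comp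
          (innerSL ℝ c) := by
      ext1 a
      refine Lp.ext ?_
      rw [Lp.simpleFunc.coe_indicatorConst]
      filter_upwards [coeffOp_ae_eq (indicatorConstLp 2 hs hμs.ne c) a,
        indicatorConstLp_coeFn (p := 2) (hs := hs) (hμs := hμs.ne) (c := c),
        indicatorConstLp_coeFn (p := 2) (hs := hs) (hμs := hμs.ne) (c := (1 : ℝ)),
        Lp.coeFn_smul (inner ℝ c a) (indicatorConstLp 2 hs hμs.ne (1 : ℝ))] with ω h1 h2 h3 h4
      rw [h1, h2]
      simp only [ContinuousLinearMap.comp_apply, innerSL_apply_apply,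
        ContinuousLinearMap.toSpanSingleton_apply, h4, Pi.smul_apply, h3]
      by_cases hω : ω ∈ t <;> simp [hω, real_inner_comm]
    rw [hrank]
    exact ((isCompactOperator_id (E := ℝ)).clm_comp
      (ContinuousLinearMap.toSpanSingleton ℝ (indicatorConstLp 2 hs hμs.ne (1 : ℝ)))).comp_clm _
  | add hf hg _ h1 h2 =>
    have := h1.add h2
    simpa [coeffOp] using! this
  | isClosed =>
    exact (isClosed_setOfPred_isCompactOperator (σ₁₂ := RingHom.id ℝ)).preimage
      (coeffOpL E P).continuous

variable [CompleteSpace E]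

/-- The covariance operator of a centred `w ∈ L²(Ω; E)`. -/
noncomputable def covCLM (w : Lp E 2 P) : E →L[ℝ] E :=
  (coeffOp w).adjoint.comp (coeffOp w)

theorem inner_covCLM_apply (w : Lp E 2 P) (a b : E) :
    inner ℝ (covCLM w a) b = inner ℝ (coeffOp w a) (coeffOp w b) :=
  ContinuousLinearMap.adjoint_inner_left (coeffOp w) b (coeffOp w a)

theorem inner_covCLM_apply_eq_integral (w : Lp E 2 P) (a b : E) :
    inner ℝ (covCLM w a) b = ∫ ω, inner ℝ a (w ω) * inner ℝ b (w ω) ∂P := by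
  rw [inner_covCLM_apply, L2.inner_def]
  refine integral_congr_ae ?_
  filter_upwards [coeffOp_ae_eq w a, coeffOp_ae_eq w b] with ω h1 h2
  rw [h1, h2]
  simp [mul_comm]

theorem isPositive_covCLM (w : Lp E 2 P) : (covCLM w).IsPositive :=
  ContinuousLinearMap.isPositive_adjoint_comp_self _

theorem isCompactOperator_covCLM (w : Lp E 2 P) : IsCompactOperator (covCLM w) :=
  (isCompactOperator_coeffOp w).clm_comp (coeffOp w).adjoint

/-- The error of the truncated expansion of `w` along an orthonormal family. -/
theorem norm_sub_sum_inner_smul_sq {ι : Type*} {ψ : ι → E} (hψ : Orthonormal ℝ ψ) (s : Finset ι)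
    (w f : Lp E 2 P) (hf : f =ᵐ[P] fun ω => w ω - ∑ i ∈ s, inner ℝ (ψ i) (w ω) • ψ i) :
    ‖f‖ ^ 2 = ‖w‖ ^ 2 - ∑ i ∈ s, inner ℝ (covCLM w (ψ i)) (ψ i) := by
  have hint : ∀ i, Integrable (fun ω => inner ℝ (ψ i) (w ω) * inner ℝ (ψ i) (w ω)) P := fun i =>
    (L2.integrable_inner (𝕜 := ℝ) (coeffOp w (ψ i)) (coeffOp w (ψ i))).congr <| by
      filter_upwards [coeffOp_ae_eq w (ψ i)] with ω h
      simp [h, sq]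
  simp only [← real_inner_self_eq_norm_sq, inner_covCLM_apply_eq_integral]
  rw [L2.inner_def, L2.inner_def, ← integral_finsetSum _ fun i _ => hint i,
    ← integral_sub (L2.integrable_inner (𝕜 := ℝ) w w) (integrable_finsetSum _ fun i _ => hint i)]
  refine integral_congr_ae ?_
  filter_upwards [hf] with ω h
  rw [h]
  have h1 : ∀ i ∈ s, inner ℝ (ψ i) (∑ j ∈ s, inner ℝ (ψ j) (w ω) • ψ j) = inner ℝ (ψ i) (w ω) :=
    fun i hi => hψ.inner_right_sum _ hi
  have h2 : inner ℝ (∑ i ∈ s, inner ℝ (ψ i) (w ω) • ψ i) (w ω) =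
      ∑ i ∈ s, inner ℝ (ψ i) (w ω) * inner ℝ (ψ i) (w ω) := by
    simp [sum_inner, real_inner_smul_left]
  have h3 : inner ℝ (∑ i ∈ s, inner ℝ (ψ i) (w ω) • ψ i) (∑ i ∈ s, inner ℝ (ψ i) (w ω) • ψ i) =
      ∑ i ∈ s, inner ℝ (ψ i) (w ω) * inner ℝ (ψ i) (w ω) := by
    rw [sum_inner]
    exact Finset.sum_congr rfl fun i hi => by rw [real_inner_smul_left, h1 i hi]
  rw [inner_sub_left, inner_sub_right, inner_sub_right, h2, h3, ← h2]
  linarith [real_inner_comm (w ω) (∑ i ∈ s, inner ℝ (ψ i) (w ω) • ψ i)]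

/-- A centred random element takes its values in the closed span of any eigensystem of its
covariance operator. -/
theorem ContinuousLinearMap.IsEigensystem.ae_mem_closedSpan {w : Lp E 2 P} {lam : ℕ → ℝ}
    {φ : ℕ → E} (h : (covCLM w).IsEigensystem lam φ) : ∀ᵐ ω ∂P, w ω ∈ closedSpan φ := by
  let f : Lp E 2 P := ((closedSpan φ)ᗮ.starProjection).compLp w
  have hf : f =ᵐ[P] fun ω => w ω - (closedSpan φ).starProjection (w ω) := by
    filter_upwards [ContinuousLinearMap.coeFn_compLp ((closedSpan φ)ᗮ.starProjection) w] with ω hω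
    rw [hω, Submodule.starProjection_orthogonal_val]
  -- E need not be separable, but f is essentially separably valued, so it may be tested against one
  -- functional a at a time. For x = a - P a, with P the projection onto the closed span, ‖⟨x, w⟩‖²
  -- = ⟨C x, x⟩ = 0.
  obtain ⟨t, ht, hft⟩ := (Lp.aestronglyMeasurable f).isSeparable_ae_range
  have hzero : f =ᵐ[P] 0 := by
    refine ae_eq_zero_of_forall_dual_of_isSeparable ℝ ht (fun c => ?_) hft
    obtain ⟨a, rfl⟩ := (InnerProductSpace.toDual ℝ E).surjective c
    have hC := h.apply_eq_zero (isPositive_covCLM w) (isCompactOperator_covCLM w)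
      ((closedSpan φ).sub_starProjection_mem_orthogonal a)
    have h0 : coeffOp w (a - (closedSpan φ).starProjection a) = 0 := by
      rw [← inner_self_eq_zero (𝕜 := ℝ), ← inner_covCLM_apply, hC, inner_zero_left]
    filter_upwards [coeffOp_ae_eq w (a - (closedSpan φ).starProjection a), hf,
      Lp.coeFn_zero ℝ 2 P] with ω h1 h2 h3
    rw [h0, h3, inner_sub_left, Submodule.inner_starProjection_left_eq_right] at h1
    rw [h2, InnerProductSpace.toDual_apply_apply, inner_sub_right]
    exact h1.symm
  filter_upwards [hzero, hf] with ω h1 h2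
  rw [h1, Pi.zero_apply, eq_comm, sub_eq_zero] at h2
  rw [h2]
  exact Submodule.starProjection_apply_mem _ _

/-- The eigenvalues of the covariance operator sum up to the total variance. -/
theorem ContinuousLinearMap.IsEigensystem.hasSum_eigenvalues {w : Lp E 2 P} {lam : ℕ → ℝ}
    {φ : ℕ → E} (h : (covCLM w).IsEigensystem lam φ) : HasSum lam (‖w‖ ^ 2) := by
  have hquad : ∀ k, inner ℝ (covCLM w (φ k)) (φ k) = lam k := fun k => by
    rw [h.eigen, real_inner_smul_left, real_inner_self_eq_norm_sq, h.orthonormal.1]; simp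
  have hlam : ∀ k, ∫ ω, inner ℝ (φ k) (w ω) ^ 2 ∂P = lam k := fun k => by
    rw [← hquad, inner_covCLM_apply_eq_integral]
    simp only [sq]
  have hint : ∀ k, Integrable (fun ω => inner ℝ (φ k) (w ω) ^ 2) P := fun k =>
    (L2.integrable_inner (𝕜 := ℝ) (coeffOp w (φ k)) (coeffOp w (φ k))).congr <| by
      filter_upwards [coeffOp_ae_eq w (φ k)] with ω h
      simp [h, sq]
  have hsum : Summable lam := by
    -- Partial sums are bounded because ‖w‖² minus each of them is the square of a truncation error.
    refine summable_of_sum_le h.nonneg (c := ‖w‖ ^ 2) fun s => ?_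
    have hmem : MemLp (fun ω => w ω - ∑ i ∈ s, inner ℝ (φ i) (w ω) • φ i) 2 P :=
      (Lp.memLp w).sub <| memLp_finsetSum _ fun i _ => by
        have := ((Lp.memLp (coeffOp w (φ i))).ae_eq (coeffOp_ae_eq w (φ i)))
        exact (ContinuousLinearMap.toSpanSingleton ℝ (φ i)).comp_memLp' this
    have := norm_sub_sum_inner_smul_sq h.orthonormal s w hmem.toLp hmem.coeFn_toLp
    simp only [hquad] at this
    nlinarith [sq_nonneg ‖hmem.toLp‖]
  have hnorm : ∀ k, ∫ ω, ‖inner ℝ (φ k) (w ω) ^ 2‖ ∂P = lam k := fun k => by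
    rw [← hlam]
    simp
  have key := hasSum_integral_of_summable_integral_norm hint (by simpa only [hnorm] using hsum)
  simp only [hlam] at key
  suffices ‖w‖ ^ 2 = ∫ ω, ∑' k, inner ℝ (φ k) (w ω) ^ 2 ∂P from this ▸ key
  rw [← real_inner_self_eq_norm_sq, L2.inner_def]
  refine integral_congr_ae ?_
  filter_upwards [h.ae_mem_closedSpan] with ω hω
  have := h.orthonormal.hasSum_inner_sq (w ω)
  rw [Submodule.starProjection_eq_self_iff.2 hω] at this
  rw [this.tsum_eq, real_inner_self_eq_norm_sq]

end RandomElements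

/-! ### Jointly measurable versions -/

section JointVersions

variable {X : Type*} [MeasurableSpace X] {μ : Measure X} {Ω : Type*} [MeasurableSpace Ω]
  {P : Measure Ω} {F : Type*} [NormedAddCommGroup F]

theorem norm_sq_eq_integral_norm_sq [InnerProductSpace ℝ F] (f : Lp F 2 μ) : ‖f‖ ^ 2 = ∫ x, ‖f x‖ ^ 2 ∂μ := by
  rw [← real_inner_self_eq_norm_sq, L2.inner_def]
  simp only [real_inner_self_eq_norm_sq]

theorem MeasureTheory.MemLp.norm_toLp_sq [InnerProductSpace ℝ F] {f : X → F} (hf : MemLp f 2 μ) :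
    ‖hf.toLp f‖ ^ 2 = ∫ x, ‖f x‖ ^ 2 ∂μ := by
  rw [norm_sq_eq_integral_norm_sq]
  exact integral_congr_ae (hf.coeFn_toLp.mono fun x hx => by simp only [hx])

/-- `V` is a jointly measurable version of the random element `v` of `L²(μ; F)`. -/
structure IsJointVersion (v : Lp (Lp F 2 μ) 2 P) (V : X → Ω → F) : Prop where
  aestronglyMeasurable : AEStronglyMeasurable (Function.uncurry V) (μ.prod P)
  ae_eq : ∀ᵐ ω ∂P, (fun x => V x ω) =ᵐ[μ] v ω

namespace IsJointVersion

variable {v v' : Lp (Lp F 2 μ) 2 P} {V V' : X → Ω → F}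

theorem add (h : IsJointVersion v V) (h' : IsJointVersion v' V') :
    IsJointVersion (v + v') fun x ω => V x ω + V' x ω := by
  refine ⟨h.aestronglyMeasurable.add h'.aestronglyMeasurable, ?_⟩
  filter_upwards [h.ae_eq, h'.ae_eq, Lp.coeFn_add v v'] with ω h1 h2 h3
  rw [h3, Pi.add_apply]
  filter_upwards [h1, h2, Lp.coeFn_add (v ω) (v' ω)] with x h4 h5 h6
  rw [h4, h5, h6, Pi.add_apply]

theorem sub (h : IsJointVersion v V) (h' : IsJointVersion v' V') :
    IsJointVersion (v - v') fun x ω => V x ω - V' x ω := by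
  refine ⟨h.aestronglyMeasurable.sub h'.aestronglyMeasurable, ?_⟩
  filter_upwards [h.ae_eq, h'.ae_eq, Lp.coeFn_sub v v'] with ω h1 h2 h3
  rw [h3, Pi.sub_apply]
  filter_upwards [h1, h2, Lp.coeFn_sub (v ω) (v' ω)] with x h4 h5 h6
  rw [h4, h5, h6, Pi.sub_apply]

theorem memLp_slice (h : IsJointVersion v V) : ∀ᵐ ω ∂P, MemLp (fun x => V x ω) 2 μ :=
  h.ae_eq.mono fun ω hω => (Lp.memLp (v ω)).ae_eq hω.symm

theorem indicatorConst (c : Lp F 2 μ) {t : Set Ω} (ht : MeasurableSet t) (hPt : P t ≠ ⊤) :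
    IsJointVersion (indicatorConstLp 2 ht hPt c) fun x => t.indicator fun _ => c x := by
  refine ⟨?_, ?_⟩
  · have h1 : AEStronglyMeasurable (fun z : X × Ω => c z.1) (μ.prod P) :=
      (Lp.aestronglyMeasurable c).comp_fst
    refine (h1.indicator (measurable_snd ht)).congr (Eventually.of_forall fun z => ?_)
    by_cases hz : z.2 ∈ t <;> simp [Function.uncurry, Set.indicator, hz]
  · filter_upwards [indicatorConstLp_coeFn (p := 2) (hs := ht) (hμs := hPt) (c := c)] with ω hω
    rw [hω]
    by_cases hω' : ω ∈ t
    · simp [Set.indicator, hω']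
    · simpa [Set.indicator, hω'] using! (Lp.coeFn_zero F 2 μ).symm

variable [InnerProductSpace ℝ F]

theorem integral_slice (h : IsJointVersion v V) :
    ∀ᵐ ω ∂P, ∫ x, ‖V x ω‖ ^ 2 ∂μ = ‖v ω‖ ^ 2 :=
  h.ae_eq.mono fun ω hω => by
    rw [norm_sq_eq_integral_norm_sq]
    exact integral_congr_ae (hω.mono fun x hx => by simp only [hx])

variable [SFinite μ] [SFinite P]

theorem memLp (h : IsJointVersion v V) : MemLp (Function.uncurry V) 2 (μ.prod P) := by
  rw [memLp_two_iff_integrable_sq_norm h.aestronglyMeasurable,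
    integrable_prod_iff' (f := fun z => ‖Function.uncurry V z‖ ^ 2)
      (h.aestronglyMeasurable.norm.pow 2)]
  refine ⟨h.memLp_slice.mono fun ω hω => (memLp_two_iff_integrable_sq_norm hω.1).1 hω, ?_⟩
  refine ((memLp_two_iff_integrable_sq_norm (Lp.aestronglyMeasurable v)).1 (Lp.memLp v)).congr ?_
  filter_upwards [h.integral_slice] with ω hω
  simp [← hω, Function.uncurry]

/-- Fubini. This isometry turns a Cauchy sequence of random elements into a Cauchy sequence of
versions on the product space, as needed in `of_tendsto`. -/
theorem norm_toLp (h : IsJointVersion v V) : ‖h.memLp.toLp (Function.uncurry V)‖ = ‖v‖ := by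
  rw [← sq_eq_sq₀ (norm_nonneg _) (norm_nonneg _), h.memLp.norm_toLp_sq,
    norm_sq_eq_integral_norm_sq v, integral_prod_symm _
    ((memLp_two_iff_integrable_sq_norm h.aestronglyMeasurable).1 h.memLp)]
  exact integral_congr_ae h.integral_slice

/-- Random elements with a jointly measurable version are closed under limits. -/
theorem of_tendsto [CompleteSpace F] {u : ℕ → Lp (Lp F 2 μ) 2 P} {W : ℕ → X → Ω → F}
    (hW : ∀ n, IsJointVersion (u n) (W n)) (hu : Tendsto u atTop (𝓝 v)) :
    ∃ V, IsJointVersion v V := by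
  let Z : ℕ → Lp F 2 (μ.prod P) := fun n => (hW n).memLp.toLp _
  have hdist : ∀ m n, dist (Z m) (Z n) = dist (u m) (u n) := fun m n => by
    rw [dist_eq_norm, dist_eq_norm, ← ((hW m).sub (hW n)).norm_toLp]
    exact congrArg norm (MemLp.toLp_sub (hW m).memLp (hW n).memLp).symm
  have hcauchy : CauchySeq Z := by
    rw [Metric.cauchySeq_iff]
    simpa only [hdist] using Metric.cauchySeq_iff.1 hu.cauchySeq
  obtain ⟨Y, hY⟩ := cauchySeq_tendsto_of_complete hcauchy
  have hYW : ∀ n, MemLp (fun z => Y z - Function.uncurry (W n) z) 2 (μ.prod P) := fun n =>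
    (Lp.memLp Y).sub (hW n).memLp
  have hYWint : ∀ n, Integrable (fun z => ‖Y z - Function.uncurry (W n) z‖ ^ 2) (μ.prod P) :=
    fun n => (memLp_two_iff_integrable_sq_norm (hYW n).1).1 (hYW n)
  have hYslice : ∀ᵐ ω ∂P, MemLp (fun x => Y (x, ω)) 2 μ := by
    have hY2 := (memLp_two_iff_integrable_sq_norm (Lp.aestronglyMeasurable Y)).1 (Lp.memLp Y)
    filter_upwards [(Lp.aestronglyMeasurable Y).prodMk_right, hY2.prod_left_ae] with ω h1 h2
    exact (memLp_two_iff_integrable_sq_norm h1).2 h2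
  let A : ℕ → Ω → ℝ := fun n ω => ∫ x, ‖Y (x, ω) - W n x ω‖ ^ 2 ∂μ
  let B : ℕ → Ω → ℝ := fun n ω => ‖(u n - v) ω‖ ^ 2
  have hA : ∀ n, Integrable (A n) P := fun n => (hYWint n).integral_prod_right
  have hB : ∀ n, Integrable (B n) P := fun n =>
    (memLp_two_iff_integrable_sq_norm (Lp.aestronglyMeasurable _)).1 (Lp.memLp _)
  have hA0 : ∀ n ω, 0 ≤ A n ω := fun n ω => integral_nonneg fun x => sq_nonneg _
  have hAint : ∀ n, ∫ ω, A n ω ∂P = ‖Y - Z n‖ ^ 2 := fun n => by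
    have : Y - Z n = (hYW n).toLp _ := by
      refine Lp.ext ?_
      filter_upwards [Lp.coeFn_sub Y (Z n), (hYW n).coeFn_toLp, (hW n).memLp.coeFn_toLp]
        with z h1 h2 h3
      rw [h1, h2, Pi.sub_apply, h3]
    rw [this, (hYW n).norm_toLp_sq, integral_prod_symm _ (hYWint n)]
    rfl
  have hlim : Tendsto (fun n => ∫ ω, (A n ω + B n ω) ∂P) atTop (𝓝 0) := by
    have h1 : Tendsto (fun n => ‖Y - Z n‖ ^ 2 + ‖u n - v‖ ^ 2) atTop (𝓝 0) := by
      have h2 := (tendsto_const_nhds (x := Y)).sub hY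
      have h3 := hu.sub (tendsto_const_nhds (x := v))
      simpa using (h2.norm.pow 2).add (h3.norm.pow 2)
    refine h1.congr fun n => ?_
    rw [integral_add (hA n) (hB n), hAint, ← norm_sq_eq_integral_norm_sq]
  -- L¹ convergence of A + B yields an almost surely convergent subsequence. Along it the slice of Y
  -- and v ω are both approached by u n ω, so they coincide.
  have hmeas : TendstoInMeasure P (fun n ω => A n ω + B n ω) atTop fun _ => (0 : ℝ) := by
    refine tendstoInMeasure_of_tendsto_eLpNorm one_ne_zero
      (fun n => ((hA n).add (hB n)).aestronglyMeasurable) aestronglyMeasurable_const ?_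
    have h1 := ENNReal.tendsto_ofReal hlim
    rw [ENNReal.ofReal_zero] at h1
    refine h1.congr fun n => ?_
    have hAB : Integrable (fun ω => A n ω + B n ω) P := (hA n).add (hB n)
    rw [eLpNorm_one_eq_lintegral_enorm, ofReal_integral_eq_lintegral_ofReal hAB
      (Eventually.of_forall fun ω => add_nonneg (hA0 n ω) (sq_nonneg _))]
    refine lintegral_congr fun ω => ?_
    simp only [Pi.sub_apply, sub_zero]
    rw [Real.enorm_of_nonneg (add_nonneg (hA0 n ω) (sq_nonneg _))]
  obtain ⟨ns, -, hns⟩ := hmeas.exists_seq_tendsto_ae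
  refine ⟨fun x ω => Y (x, ω), Lp.aestronglyMeasurable Y, ?_⟩
  filter_upwards [hns, hYslice, ae_all_iff.2 fun n => (hW n).ae_eq,
    ae_all_iff.2 fun n => Lp.coeFn_sub (u n) v] with ω hω hYω hWω hsub
  have hle : ∀ n, ‖hYω.toLp _ - v ω‖ ^ 2 ≤ 2 * (A n ω + B n ω) := fun n => by
    have hAn : A n ω = ‖hYω.toLp _ - u n ω‖ ^ 2 := by
      rw [norm_sq_eq_integral_norm_sq]
      refine integral_congr_ae ?_
      filter_upwards [hWω n, hYω.coeFn_toLp, Lp.coeFn_sub (hYω.toLp _) (u n ω)] with x h1 h2 h3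
      simp only [h3, Pi.sub_apply, h2, ← h1]
    have hBn : B n ω = ‖u n ω - v ω‖ ^ 2 := by simp only [B, hsub n, Pi.sub_apply]
    have htri := norm_sub_le_norm_sub_add_norm_sub (hYω.toLp _) (u n ω) (v ω)
    rw [hAn, hBn]
    nlinarith [sq_nonneg (‖hYω.toLp _ - u n ω‖ - ‖u n ω - v ω‖), norm_nonneg (hYω.toLp _ - v ω)]
  have hzero : ‖hYω.toLp _ - v ω‖ ^ 2 ≤ 0 :=
    ge_of_tendsto' (by simpa using hω.const_mul 2) fun n => hle (ns n)
  have heq : hYω.toLp _ = v ω := by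
    have := pow_eq_zero_iff two_ne_zero |>.1 (le_antisymm hzero (sq_nonneg _))
    exact sub_eq_zero.1 (norm_eq_zero.1 this)
  rw [← heq]
  exact hYω.coeFn_toLp.symm

end IsJointVersion

/-- Every square-integrable random element of `L²(μ; F)` has a jointly measurable version. -/
theorem exists_isJointVersion [InnerProductSpace ℝ F] [SFinite μ] [SFinite P] [CompleteSpace F]
    (v : Lp (Lp F 2 μ) 2 P) : ∃ V, IsJointVersion v V := by
  induction v using Lp.induction (p := 2) ENNReal.ofNat_ne_top with
  | indicatorConst c hs hPs =>
    rw [Lp.simpleFunc.coe_indicatorConst]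
    exact ⟨_, IsJointVersion.indicatorConst c hs hPs.ne⟩
  | add hf hg _ h1 h2 =>
    obtain ⟨V, hV⟩ := h1
    obtain ⟨V', hV'⟩ := h2
    exact ⟨_, hV.add hV'⟩
  | isClosed =>
    refine IsSeqClosed.isClosed fun u v hu huv => ?_
    choose W hW using hu
    exact IsJointVersion.of_tendsto hW huv

end JointVersions

/-! ### Fubini arguments: square-integrable kernels and pointwise means -/

section JointVersions

variable {X : Type*} [MeasurableSpace X] {μ : Measure X} {Ω : Type*} [MeasurableSpace Ω]
  {P : Measure Ω} {F : Type*} [NormedAddCommGroup F]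

/-- The Cauchy-Schwarz inequality for integrals. -/
theorem sq_integral_mul_le {f g : X → ℝ} (hf : MemLp f 2 μ) (hg : MemLp g 2 μ) :
    (∫ x, f x * g x ∂μ) ^ 2 ≤ (∫ x, f x ^ 2 ∂μ) * ∫ x, g x ^ 2 ∂μ := by
  have h := real_inner_mul_inner_self_le (hf.toLp f) (hg.toLp g)
  have hfg : ∀ {f g : X → ℝ} (hf : MemLp f 2 μ) (hg : MemLp g 2 μ),
      inner ℝ (hf.toLp f) (hg.toLp g) = ∫ x, f x * g x ∂μ := fun hf hg => by
    rw [L2.inner_def]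
    refine integral_congr_ae ?_
    filter_upwards [hf.coeFn_toLp, hg.coeFn_toLp] with x h1 h2
    rw [h1, h2]
    simp [mul_comm]
  simpa only [hfg, ← sq] using h

theorem MeasureTheory.MemLp.ae_memLp_prodMk_left [SFinite μ] [SFinite P] {f : X × Ω → F}
    (hf : MemLp f 2 (μ.prod P)) : ∀ᵐ x ∂μ, MemLp (fun ω => f (x, ω)) 2 P := by
  have h := (memLp_two_iff_integrable_sq_norm hf.1).1 hf
  filter_upwards [hf.1.prodMk_left, h.prod_right_ae] with x h1 h2
  exact (memLp_two_iff_integrable_sq_norm h1).2 h2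

/-- The weighted marginal of a square-integrable function is square-integrable. -/
theorem MeasureTheory.MemLp.integral_smul_prod [NormedSpace ℝ F] [SFinite μ] [SFinite P]
    {s : Ω → ℝ} (hs : MemLp s 2 P) {f : X × Ω → F} (hf : MemLp f 2 (μ.prod P)) :
    MemLp (fun x => ∫ ω, s ω • f (x, ω) ∂P) 2 μ := by
  have hmeas : AEStronglyMeasurable (fun x => ∫ ω, s ω • f (x, ω) ∂P) μ :=
    (hs.1.comp_snd.smul hf.1).integral_prod_right'
  have hint := ((memLp_two_iff_integrable_sq_norm hf.1).1 hf).integral_prod_left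
  rw [memLp_two_iff_integrable_sq_norm hmeas]
  refine (hint.const_mul (∫ ω, ‖s ω‖ ^ 2 ∂P)).mono' (hmeas.norm.pow 2) ?_
  filter_upwards [hf.ae_memLp_prodMk_left] with x hx
  rw [Real.norm_of_nonneg (sq_nonneg _)]
  calc ‖∫ ω, s ω • f (x, ω) ∂P‖ ^ 2 ≤ (∫ ω, ‖s ω‖ * ‖f (x, ω)‖ ∂P) ^ 2 := by
        gcongr
        exact (norm_integral_le_integral_norm _).trans_eq (by simp only [norm_smul])
    _ ≤ _ := sq_integral_mul_le hs.norm hx.norm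

/-- Correlation kernels of square-integrable functions are square-integrable. -/
theorem MeasureTheory.MemLp.integral_mul_kernel [SFinite μ] [SFinite P] {f g : X × Ω → ℝ}
    (hf : MemLp f 2 (μ.prod P)) (hg : MemLp g 2 (μ.prod P)) :
    MemLp (fun z : X × X => ∫ ω, f (z.1, ω) * g (z.2, ω) ∂P) 2 (μ.prod μ) := by
  have h1 : Measure.QuasiMeasurePreserving (fun z : (X × X) × Ω => (z.1.1, z.2))
      ((μ.prod μ).prod P) (μ.prod P) :=
    MeasureTheory.QuasiMeasurePreserving.prodMap Measure.quasiMeasurePreserving_fst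
      (Measure.QuasiMeasurePreserving.id P)
  have h2 : Measure.QuasiMeasurePreserving (fun z : (X × X) × Ω => (z.1.2, z.2))
      ((μ.prod μ).prod P) (μ.prod P) :=
    MeasureTheory.QuasiMeasurePreserving.prodMap Measure.quasiMeasurePreserving_snd
      (Measure.QuasiMeasurePreserving.id P)
  have hmeas : AEStronglyMeasurable (fun z : X × X => ∫ ω, f (z.1, ω) * g (z.2, ω) ∂P)
      (μ.prod μ) :=
    ((hf.1.comp_quasiMeasurePreserving h1).mul
      (hg.1.comp_quasiMeasurePreserving h2)).integral_prod_right'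
  have hfi := ((memLp_two_iff_integrable_sq hf.1).1 hf).integral_prod_left
  have hgi := ((memLp_two_iff_integrable_sq hg.1).1 hg).integral_prod_left
  rw [memLp_two_iff_integrable_sq hmeas]
  -- Cauchy–Schwarz in ω bounds the squared kernel at (x, y) by a function of x times a function of
  -- y, each integrable.
  refine (hfi.mul_prod hgi).mono' (hmeas.pow 2) ?_
  filter_upwards [Measure.quasiMeasurePreserving_fst.ae hf.ae_memLp_prodMk_left,
    Measure.quasiMeasurePreserving_snd.ae hg.ae_memLp_prodMk_left] with z hz1 hz2
  rw [Real.norm_of_nonneg (sq_nonneg _)]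
  exact sq_integral_mul_le hz1 hz2

variable [InnerProductSpace ℝ F]

theorem MeasureTheory.MemLp.smul_prod_snd [SFinite P] [SFinite μ] {s : Ω → ℝ} (hs : MemLp s 2 P)
    {g : X → F} (hg : MemLp g 2 μ) : MemLp (fun z : X × Ω => s z.2 • g z.1) 2 (μ.prod P) := by
  have hmeas : AEStronglyMeasurable (fun z : X × Ω => s z.2 • g z.1) (μ.prod P) :=
    hs.1.comp_snd.smul hg.1.comp_fst
  rw [memLp_two_iff_integrable_sq_norm hmeas]
  refine ((((memLp_two_iff_integrable_sq_norm hg.1).1 hg).mul_prod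
    ((memLp_two_iff_integrable_sq_norm hs.1).1 hs))).congr (Eventually.of_forall fun z => ?_)
  simp only [norm_smul, mul_pow, mul_comm]

theorem MeasureTheory.MemLp.integrable_inner {f g : X → F} (hf : MemLp f 2 μ)
    (hg : MemLp g 2 μ) : Integrable (fun x => inner ℝ (f x) (g x)) μ := by
  refine (L2.integrable_inner (𝕜 := ℝ) (hf.toLp f) (hg.toLp g)).congr ?_
  filter_upwards [hf.coeFn_toLp, hg.coeFn_toLp] with x h1 h2
  rw [h1, h2]

theorem MeasureTheory.MemLp.integrable_smul_Lp {s : Ω → ℝ} (hs : MemLp s 2 P) {f : Ω → F}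
    (hf : MemLp f 2 P) : Integrable (fun ω => s ω • f ω) P :=
  memLp_one_iff_integrable.1 (hf.smul (r := 1) hs)

/-- The weighted mean of a random element of `L²(μ; F)` is given pointwise by the weighted mean
of any jointly measurable version. -/
theorem IsJointVersion.integral_smul_ae_eq [CompleteSpace F] [SFinite μ] [SFinite P]
    {v : Lp (Lp F 2 μ) 2 P} {V : X → Ω → F} (h : IsJointVersion v V) {s : Ω → ℝ}
    (hs : MemLp s 2 P) :
    (∫ ω, s ω • v ω ∂P : Lp F 2 μ) =ᵐ[μ] fun x => ∫ ω, s ω • V x ω ∂P := by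
  have hm : MemLp (fun x => ∫ ω, s ω • V x ω ∂P) 2 μ := hs.integral_smul_prod h.memLp
  suffices heq : (∫ ω, s ω • v ω ∂P : Lp F 2 μ) = hm.toLp _ by
    rw [heq]; exact hm.coeFn_toLp
  have hint : Integrable (fun ω => s ω • v ω) P := hs.integrable_smul_Lp (Lp.memLp v)
  -- Two elements of L²(μ; F) agree if their inner products with every g do; Fubini applies since
  -- s(ω) g(x) and V are both square-integrable on the product.
  refine ext_inner_left ℝ fun g => ?_
  rw [← integral_inner hint]
  have hprod : Integrable (Function.uncurry fun x ω => inner ℝ (s ω • g x) (V x ω)) (μ.prod P) :=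
    (hs.smul_prod_snd (Lp.memLp g)).integrable_inner h.memLp
  calc ∫ ω, inner ℝ g (s ω • v ω) ∂P
      = ∫ ω, ∫ x, inner ℝ (s ω • g x) (V x ω) ∂μ ∂P := by
        refine integral_congr_ae ?_
        filter_upwards [h.ae_eq] with ω hω
        rw [real_inner_smul_right, L2.inner_def, ← integral_const_mul]
        refine integral_congr_ae ?_
        filter_upwards [hω] with x hx
        rw [← hx, real_inner_smul_left]
    _ = ∫ x, ∫ ω, inner ℝ (s ω • g x) (V x ω) ∂P ∂μ := (integral_integral_swap hprod).symm
    _ = inner ℝ g (hm.toLp _) := by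
        rw [L2.inner_def]
        refine integral_congr_ae ?_
        filter_upwards [hm.coeFn_toLp, h.memLp.ae_memLp_prodMk_left] with x h1 h2
        have h3 : Integrable (fun ω => s ω • V x ω) P := hs.integrable_smul_Lp h2
        rw [h1, ← integral_inner h3]
        refine integral_congr_ae (Eventually.of_forall fun ω => ?_)
        simp only [real_inner_smul_left, real_inner_smul_right]

end JointVersions

/-! ### The covariance operator as a Bochner integral -/

section RandomElements

variable {E : Type*} [NormedAddCommGroup E] [InnerProductSpace ℝ E] [CompleteSpace E]
  {Ω : Type*} [MeasurableSpace Ω] {P : Measure Ω}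

/-- This exhibits the operator's values as weighted means of w with weight ⟨a, w⟩, the form to which
`IsJointVersion.integral_smul_ae_eq` applies. -/
theorem covCLM_apply_eq_integral (w : Lp E 2 P) (a : E) :
    covCLM w a = ∫ ω, inner ℝ a (w ω) • w ω ∂P := by
  have hint : Integrable (fun ω => inner ℝ a (w ω) • w ω) P :=
    ((Lp.memLp w).const_inner a).integrable_smul_Lp (Lp.memLp w)
  refine ext_inner_left ℝ fun b => ?_
  rw [← integral_inner hint, real_inner_comm, inner_covCLM_apply_eq_integral]
  simp only [real_inner_smul_right]

end RandomElements

/-! ### Identification of the covariance integral operator -/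

section RandomFields

variable {d q : ℕ} {Ω : Type*} [MeasurableSpace Ω] {P : Measure Ω}
  {U : Set (EuclideanSpace ℝ (Fin d))} {v : RandomField P U q}
  {V : EuclideanSpace ℝ (Fin d) → Ω → EuclideanSpace ℝ (Fin q)}

theorem IsPointwiseVersion.isJointVersion (h : IsPointwiseVersion v V) : IsJointVersion v V :=
  ⟨h.1, h.2⟩

variable [IsProbabilityMeasure P]

theorem exists_isPointwiseVersion (v : RandomField P U q) : ∃ V, IsPointwiseVersion v V :=
  let ⟨V, hV⟩ := exists_isJointVersion v
  ⟨V, hV.1, hV.2⟩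

/-- The centred random field. -/
noncomputable def centered (v : RandomField P U q) : RandomField P U q :=
  v - Lp.const 2 P (meanField v)

theorem centered_ae_eq (v : RandomField P U q) :
    centered v =ᵐ[P] fun ω => v ω - meanField v := by
  filter_upwards [Lp.coeFn_sub v (Lp.const 2 P (meanField v)),
    Lp.coeFn_const (p := 2) (μ := P) (meanField v)] with ω h1 h2
  rw [centered, h1, Pi.sub_apply, h2, Function.const_apply]

theorem integral_inner_centered (v : RandomField P U q) (u : L2Field U q) :
    ∫ ω, inner ℝ u (centered v ω) ∂P = 0 := by
  have hv : Integrable (v : Ω → L2Field U q) P := (Lp.memLp v).integrable one_le_two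
  have h1 : Integrable (centered v : Ω → L2Field U q) P :=
    (Lp.memLp (centered v)).integrable one_le_two
  rw [integral_inner h1, integral_congr_ae (centered_ae_eq v),
    integral_sub hv (integrable_const _)]
  simp [meanField]

namespace IsPointwiseVersion

theorem meanField_ae_eq (h : IsPointwiseVersion v V) :
    meanField v =ᵐ[volume.restrict U] fun x => ∫ ω, V x ω ∂P := by
  have := h.isJointVersion.integral_smul_ae_eq (memLp_const (1 : ℝ))
  simp only [one_smul] at this
  exact this

theorem isJointVersion_centered (h : IsPointwiseVersion v V) :
    IsJointVersion (centered v) fun x ω => V x ω - meanField v x := by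
  have hconst : IsJointVersion (Lp.const 2 P (meanField v)) fun x _ => meanField v x :=
    ⟨(Lp.aestronglyMeasurable (meanField v)).comp_fst,
      (Lp.coeFn_const (p := 2) (μ := P) (meanField v)).mono fun ω hω => by
        rw [hω, Function.const_apply]⟩
  exact h.isJointVersion.sub hconst

theorem ae_memLp (h : IsPointwiseVersion v V) :
    ∀ᵐ x ∂(volume.restrict U), MemLp (V x) 2 P ∧ meanField v x = ∫ ω, V x ω ∂P := by
  filter_upwards [h.isJointVersion.memLp.ae_memLp_prodMk_left, h.meanField_ae_eq] with x h1 h2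
  exact ⟨h1, h2⟩

end IsPointwiseVersion

/-- The covariances as correlations of the centred field. -/
theorem covMatrix_apply_eq_integral {m : EuclideanSpace ℝ (Fin d) → EuclideanSpace ℝ (Fin q)}
    {x y : EuclideanSpace ℝ (Fin d)} (hx : MemLp (V x) 2 P) (hmx : m x = ∫ ω, V x ω ∂P)
    (hy : MemLp (V y) 2 P) (hmy : m y = ∫ ω, V y ω ∂P) (i j : Fin q) :
    covMatrix P V x y i j = ∫ ω, (V x ω - m x) i * (V y ω - m y) j ∂P := by
  have hcoord : ∀ {z : EuclideanSpace ℝ (Fin d)}, MemLp (V z) 2 P → m z = ∫ ω, V z ω ∂P →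
      ∀ k, ∫ ω, V z ω k ∂P = m z k := fun hz hmz k => by
    rw [hmz]
    exact (EuclideanSpace.proj k : EuclideanSpace ℝ (Fin q) →L[ℝ] ℝ).integral_comp_comm
      (hz.integrable one_le_two)
  simp only [covMatrix, Matrix.of_apply, covariance, hcoord hx hmx, hcoord hy hmy, PiLp.sub_apply]

theorem IsPointwiseVersion.memLp_covMatrix (h : IsPointwiseVersion v V) (i j : Fin q) :
    MemLp (fun z : EuclideanSpace ℝ (Fin d) × EuclideanSpace ℝ (Fin d) =>
      covMatrix P V z.1 z.2 i j) 2 ((volume.restrict U).prod (volume.restrict U)) := by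
  have hcoord : ∀ k, MemLp (fun z : EuclideanSpace ℝ (Fin d) × Ω =>
      (V z.1 z.2 - meanField v z.1) k) 2 ((volume.restrict U).prod P) := fun k =>
    (EuclideanSpace.proj k : EuclideanSpace ℝ (Fin q) →L[ℝ] ℝ).comp_memLp'
      h.isJointVersion_centered.memLp
  refine ((hcoord i).integral_mul_kernel (hcoord j)).ae_eq ?_
  filter_upwards [Measure.quasiMeasurePreserving_fst.ae h.ae_memLp,
    Measure.quasiMeasurePreserving_snd.ae h.ae_memLp] with z h1 h2
  exact (covMatrix_apply_eq_integral h1.1 h1.2 h2.1 h2.2 i j).symm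

/-- The kernel is a correlation of the centred field W, so the y-integral may be carried out before
the expectation. It produces ⟨u, w(ω)⟩, and the mean of ⟨u, w⟩ W(x, ·) is the value of `covCLM` at
almost every x. -/
theorem IsPointwiseVersion.covOp_ae_eq (h : IsPointwiseVersion v V) (u : L2Field U q) :
    covOp P U V u =ᵐ[volume.restrict U] covCLM (centered v) u := by
  let W : EuclideanSpace ℝ (Fin d) → Ω → EuclideanSpace ℝ (Fin q) :=
    fun x ω => V x ω - meanField v x
  have hW : IsJointVersion (centered v) W := h.isJointVersion_centered
  have hs : MemLp (fun ω => inner ℝ u (centered v ω)) 2 P := (Lp.memLp (centered v)).const_inner u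
  rw [covCLM_apply_eq_integral]
  filter_upwards [h.ae_memLp, hW.integral_smul_ae_eq hs, hW.memLp.ae_memLp_prodMk_left]
    with x hx hCx hWx
  have hWx' : MemLp (W x) 2 P := hWx
  rw [hCx]
  have hprod : Integrable (Function.uncurry fun y ω => inner ℝ (u y) (W y ω) • W x ω)
      ((volume.restrict U).prod P) := by
    -- For fixed x with W x in L²(Ω), the integrand is dominated by ‖W x ω‖ ‖u y‖ times ‖W y ω‖, a
    -- product of two square-integrable functions of (y, ω).
    have hbound : Integrable (fun z : EuclideanSpace ℝ (Fin d) × Ω =>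
        (‖W x z.2‖ • ‖u z.1‖) * ‖W z.1 z.2‖) ((volume.restrict U).prod P) :=
      (hWx'.norm.smul_prod_snd (Lp.memLp u).norm).integrable_mul hW.memLp.norm
    have hmeas : AEStronglyMeasurable (fun z : EuclideanSpace ℝ (Fin d) × Ω =>
        inner ℝ (u z.1) (W z.1 z.2) • W x z.2) ((volume.restrict U).prod P) :=
      ((Lp.aestronglyMeasurable u).comp_fst.inner (𝕜 := ℝ) hW.aestronglyMeasurable).smul
        hWx'.1.comp_snd
    refine hbound.mono' hmeas (Eventually.of_forall fun z => ?_)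
    simp only [Function.uncurry, norm_smul, smul_eq_mul]
    calc ‖inner ℝ (u z.1) (W z.1 z.2)‖ * ‖W x z.2‖
        ≤ (‖u z.1‖ * ‖W z.1 z.2‖) * ‖W x z.2‖ := by
          gcongr
          exact norm_inner_le_norm _ _
      _ = _ := by ring
  have hkernel : ∀ᵐ y ∂(volume.restrict U),
      WithLp.toLp 2 (Matrix.mulVec (covMatrix P V x y) (u y)) =
        ∫ ω, inner ℝ (u y) (W y ω) • W x ω ∂P := by
    filter_upwards [h.ae_memLp, hprod.prod_right_ae] with y hy hint
    ext i
    have hcomp := (EuclideanSpace.proj i : EuclideanSpace ℝ (Fin q) →L[ℝ] ℝ).integral_comp_comm hint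
    have hWy : MemLp (W y) 2 P := hy.1.sub (memLp_const _)
    have hterm : ∀ j, Integrable (fun ω => W x ω i * W y ω j * u y j) P := fun j =>
      (((EuclideanSpace.proj i : EuclideanSpace ℝ (Fin q) →L[ℝ] ℝ).comp_memLp' hWx').integrable_mul
        ((EuclideanSpace.proj j : EuclideanSpace ℝ (Fin q) →L[ℝ] ℝ).comp_memLp' hWy)).mul_const _
    refine Eq.trans ?_ hcomp
    simp only [Matrix.mulVec, dotProduct, covMatrix_apply_eq_integral hx.1 hx.2 hy.1 hy.2,
      ← integral_mul_const]
    rw [← integral_finsetSum _ fun j _ => hterm j]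
    refine integral_congr_ae (Eventually.of_forall fun ω => ?_)
    change _ = inner ℝ (u y) (W y ω) * W x ω i
    rw [PiLp.inner_apply, Finset.sum_mul]
    refine Finset.sum_congr rfl fun j _ => ?_
    simp [W]
    ring
  calc covOp P U V u x = ∫ y in U, ∫ ω, inner ℝ (u y) (W y ω) • W x ω ∂P :=
        integral_congr_ae hkernel
    _ = ∫ ω, (∫ y in U, inner ℝ (u y) (W y ω) • W x ω) ∂P := integral_integral_swap hprod
    _ = ∫ ω, inner ℝ u (centered v ω) • W x ω ∂P := by
        refine integral_congr_ae ?_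
        filter_upwards [hW.ae_eq] with ω hω
        rw [integral_smul_const, L2.inner_def]
        congr 1
        refine integral_congr_ae ?_
        filter_upwards [hω] with y hy
        rw [hy]

theorem IsPointwiseVersion.covEigen_iff (h : IsPointwiseVersion v V) (μ : ℝ) (u : L2Field U q) :
    CovEigen P V μ u ↔ covCLM (centered v) u = μ • u := by
  constructor
  · intro hu
    refine Lp.ext ?_
    filter_upwards [h.covOp_ae_eq u, hu, Lp.coeFn_smul μ u] with x h1 h2 h3
    rw [← h1, h2, h3, Pi.smul_apply]
  · intro hu
    have h1 := h.covOp_ae_eq u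
    rw [hu] at h1
    exact h1.trans (Lp.coeFn_smul μ u)

theorem IsPointwiseVersion.isCovEigensystem_iff (h : IsPointwiseVersion v V) (lam : ℕ → ℝ)
    (φ : ℕ → L2Field U q) :
    IsCovEigensystem P V lam φ ↔ (covCLM (centered v)).IsEigensystem lam φ :=
  ⟨fun s => ⟨s.nonneg, s.antitone, s.orthonormal, fun k => (h.covEigen_iff _ _).1 (s.eigen k),
      fun μ u hμ hu => s.exhaustive μ u hμ ((h.covEigen_iff _ _).2 hu)⟩,
    fun s => ⟨s.nonneg, s.antitone, s.orthonormal, fun k => (h.covEigen_iff _ _).2 (s.eigen k),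
      fun μ u hμ hu => s.exhaustive μ u hμ ((h.covEigen_iff _ _).1 hu)⟩⟩

end RandomFields

/-! ### Infinite dimension of the field space; projections onto tensor subspaces -/

section RandomFields

variable {d q : ℕ} {Ω : Type*} [MeasurableSpace Ω] {P : Measure Ω}
  {U : Set (EuclideanSpace ℝ (Fin d))}

/-- An orthonormal sequence indexed by ℕ needs infinite dimension. A ball inside U contains
infinitely many disjoint nonempty open sets, of finite positive measure; their indicators times a
fixed unit vector are nonzero and orthogonal. -/
theorem not_finiteDimensional_L2Field (hd : 0 < d) (hq : 0 < q) (hU : IsOpen U)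
    (hUne : U.Nonempty) : ¬ FiniteDimensional ℝ (L2Field U q) := by
  obtain ⟨x, hx⟩ := hUne
  obtain ⟨r, hr, hball⟩ := Metric.isOpen_iff.1 hU x hx
  have : Nonempty (Fin d) := ⟨⟨0, hd⟩⟩
  have : NeBot (𝓝[≠] x) := Module.punctured_nhds_neBot ℝ (EuclideanSpace ℝ (Fin d)) x
  have : Infinite (Metric.ball x r) :=
    (infinite_of_mem_nhds x (Metric.ball_mem_nhds x hr)).to_subtype
  obtain ⟨A, hAinf, hAopen, hAdisj⟩ := exists_seq_infinite_isOpen_pairwise_disjoint (Metric.ball x r)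
  let B : ℕ → Set (EuclideanSpace ℝ (Fin d)) := fun n => Subtype.val '' A n
  have hBopen : ∀ n, IsOpen (B n) := fun n =>
    Metric.isOpen_ball.isOpenMap_subtype_val _ (hAopen n)
  have hBball : ∀ n, B n ⊆ Metric.ball x r := fun n => by rintro _ ⟨y, -, rfl⟩; exact y.2
  have hBU : ∀ n, (volume.restrict U) (B n) = volume (B n) := fun n => by
    rw [Measure.restrict_apply (hBopen n).measurableSet,
      Set.inter_eq_left.2 ((hBball n).trans hball)]
  have hBfin : ∀ n, (volume.restrict U) (B n) ≠ ⊤ := fun n => by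
    rw [hBU]
    exact ((measure_mono (hBball n)).trans_lt measure_ball_lt_top).ne
  have hBpos : ∀ n, (volume.restrict U) (B n) ≠ 0 := fun n => by
    rw [hBU]
    exact ((hBopen n).measure_pos _ ((hAinf n).nonempty.image _)).ne'
  let c : EuclideanSpace ℝ (Fin q) := EuclideanSpace.single ⟨0, hq⟩ 1
  let f : ℕ → L2Field U q := fun n =>
    indicatorConstLp 2 (hBopen n).measurableSet (hBfin n) c
  have hf : LinearIndependent ℝ f := by
    refine linearIndependent_of_ne_zero_of_inner_eq_zero (𝕜 := ℝ) (fun n hn => ?_)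
      fun m n hmn => ?_
    · have hself : inner ℝ (f n) (f n) = (volume.restrict U).real (B n) • (inner ℝ c c : ℝ) := by
        simp only [f]
        rw [L2.inner_indicatorConstLp_indicatorConstLp (hμs := hBfin n) (hμt := hBfin n),
          Set.inter_self]
      rw [hn, inner_zero_left] at hself
      have hcc : inner ℝ c c = (1 : ℝ) := by
        rw [real_inner_self_eq_norm_sq]; simp [c]
      rw [hcc, smul_eq_mul, mul_one, eq_comm, measureReal_eq_zero_iff (hBfin n)] at hself
      exact hBpos n hself
    · have hBdisj : B m ∩ B n = ∅ := by
        simp only [B]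
        rw [← Set.image_inter Subtype.val_injective, (hAdisj hmn).inter_eq, Set.image_empty]
      change inner ℝ (f m) (f n) = 0
      simp only [f]
      rw [L2.inner_indicatorConstLp_indicatorConstLp (hμs := hBfin m) (hμt := hBfin n), hBdisj]
      simp
  intro hfin
  exact Module.Finite.not_linearIndependent_of_infinite f hf

theorem elemTensor_ae_eq (φ : L2Field U q) (s : Lp ℝ 2 P) :
    elemTensor φ s =ᵐ[P] fun ω => s ω • φ :=
  (ContinuousLinearMap.coeFn_compLp _ s).mono fun ω hω => by
    rw [elemTensor, hω, ContinuousLinearMap.toSpanSingleton_apply]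

theorem sum_elemTensor_coeffOp_ae_eq {M : ℕ} (ψ : Fin M → L2Field U q) (w : RandomField P U q) :
    (∑ i, elemTensor (ψ i) (coeffOp w (ψ i)) : RandomField P U q) =ᵐ[P]
      fun ω => ∑ i, inner ℝ (ψ i) (w ω) • ψ i := by
  have h1 : ((∑ i, elemTensor (ψ i) (coeffOp w (ψ i)) : RandomField P U q) :
      Ω → L2Field U q) =ᵐ[P] fun ω => ∑ i, elemTensor (ψ i) (coeffOp w (ψ i)) ω :=
    (Lp.coeFn_finsetSum _ _).trans (Eventually.of_forall fun ω => Finset.sum_apply _ _ _)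
  filter_upwards [h1, ae_all_iff.2 fun i => elemTensor_ae_eq (ψ i) (coeffOp w (ψ i)),
    ae_all_iff.2 fun i => coeffOp_ae_eq w (ψ i)] with ω h2 h3 h4
  rw [h2]
  exact Finset.sum_congr rfl fun i _ => by rw [h3, h4]

/-- The best approximation of a random field by random elements of the span of an orthonormal
family is its expansion along this family. -/
theorem starProjection_tensorSubspace {M : ℕ} {ψ : Fin M → L2Field U q} (hψ : Orthonormal ℝ ψ)
    (w : RandomField P U q) :
    (tensorSubspace P (Submodule.span ℝ (Set.range ψ))).starProjection w =
      ∑ i, elemTensor (ψ i) (coeffOp w (ψ i)) := by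
  refine Submodule.eq_starProjection_of_mem_orthogonal ?_ ?_
  · refine Submodule.le_topologicalClosure _ (Submodule.sum_mem _ fun i _ => ?_)
    exact Submodule.subset_span ⟨ψ i, Submodule.subset_span ⟨i, rfl⟩, _, rfl⟩
  -- Orthogonality to elementary tensors holds pointwise in ω: the residual is orthogonal in L²(U;
  -- ℝ^q) to every ψ j, hence to their span.
  · rw [tensorSubspace, Submodule.orthogonal_closure, Submodule.mem_orthogonal]
    intro u hu
    induction hu using Submodule.span_induction with
    | mem u hu =>
      obtain ⟨φ, hφ, s, rfl⟩ := hu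
      rw [L2.inner_def]
      refine integral_eq_zero_of_ae ?_
      filter_upwards [elemTensor_ae_eq φ s, sum_elemTensor_coeffOp_ae_eq ψ w,
        Lp.coeFn_sub w (∑ i, elemTensor (ψ i) (coeffOp w (ψ i)))] with ω h1 h2 h3
      rw [h1, h3, Pi.sub_apply, h2, real_inner_smul_left, Pi.zero_apply]
      refine mul_eq_zero_of_right _ ?_
      clear h1
      induction hφ using Submodule.span_induction with
      | mem y hy =>
        obtain ⟨j, rfl⟩ := hy
        rw [inner_sub_right, hψ.inner_right_sum _ (Finset.mem_univ j), sub_self]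
      | zero => exact inner_zero_left _
      | add a b _ _ ha hb => rw [inner_add_left, ha, hb, add_zero]
      | smul c a _ ha => rw [real_inner_smul_left, ha, mul_zero]
    | zero => exact inner_zero_left _
    | add a b _ _ ha hb => rw [inner_add_left, ha, hb, add_zero]
    | smul c a _ ha => rw [real_inner_smul_left, ha, mul_zero]

/-- This turns minimizing the error into maximizing the trace of the covariance operator. -/
theorem projError_sq {M : ℕ} {ψ : Fin M → L2Field U q} (hψ : Orthonormal ℝ ψ)
    (w : RandomField P U q) :
    projError w (Submodule.span ℝ (Set.range ψ)) ^ 2 =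
      ‖w‖ ^ 2 - ∑ i, inner ℝ (covCLM w (ψ i)) (ψ i) := by
  rw [projError, starProjection_tensorSubspace hψ]
  refine norm_sub_sum_inner_smul_sq hψ _ w _ ?_
  filter_upwards [sum_elemTensor_coeffOp_ae_eq ψ w,
    Lp.coeFn_sub w (∑ i, elemTensor (ψ i) (coeffOp w (ψ i)))] with ω h1 h2
  rw [h2, Pi.sub_apply, h1]

end RandomFields

/-! ### Optimal subspaces and Karhunen–Loève coefficients -/

section RandomFields

variable {d q : ℕ} {Ω : Type*} [MeasurableSpace Ω] {P : Measure Ω}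
  {U : Set (EuclideanSpace ℝ (Fin d))}

section Optimality

variable {w : RandomField P U q} {lam : ℕ → ℝ} {φ : ℕ → L2Field U q}

/-- Here e is the error, T the trace over H, S the head sum and t the tail of the eigenvalues: the
error is optimal exactly when the trace is maximal. -/
theorem eq_sqrt_iff_of_sq_eq {e t T S : ℝ} (he : 0 ≤ e) (ht : 0 ≤ t) (h : e ^ 2 = S + t - T) :
    e = √t ↔ T = S := by
  rw [eq_comm, Real.sqrt_eq_iff_eq_sq ht he, h]
  constructor <;> intro h' <;> linarith

namespace ContinuousLinearMap.IsEigensystem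

theorem inner_apply_self {E : Type*} [NormedAddCommGroup E] [InnerProductSpace ℝ E]
    {T : E →L[ℝ] E} {lam : ℕ → ℝ} {φ : ℕ → E} (h : T.IsEigensystem lam φ) (k l : ℕ) :
    inner ℝ (T (φ k)) (φ l) = lam k * if k = l then 1 else 0 := by
  rw [h.eigen, real_inner_smul_left, orthonormal_iff_ite.1 h.orthonormal]

theorem norm_sq_eq_sum_add_tail (h : (covCLM w).IsEigensystem lam φ) (M : ℕ) :
    ‖w‖ ^ 2 = ∑ k ∈ Finset.range M, lam k + ∑' k, lam (M + k) := by
  rw [← h.hasSum_eigenvalues.tsum_eq, ← h.hasSum_eigenvalues.summable.sum_add_tsum_nat_add M]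
  simp only [add_comm]

theorem tail_nonneg (h : (covCLM w).IsEigensystem lam φ) (M : ℕ) : 0 ≤ ∑' k, lam (M + k) :=
  tsum_nonneg fun _ => h.nonneg _

theorem projError_sq_eq (h : (covCLM w).IsEigensystem lam φ) {M : ℕ} {ψ : Fin M → L2Field U q}
    (hψ : Orthonormal ℝ ψ) :
    projError w (Submodule.span ℝ (Set.range ψ)) ^ 2 =
      ∑ k ∈ Finset.range M, lam k + ∑' k, lam (M + k) -
        ∑ i, inner ℝ (covCLM w (ψ i)) (ψ i) := by
  rw [projError_sq hψ, h.norm_sq_eq_sum_add_tail M]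

theorem projError_span_eq (h : (covCLM w).IsEigensystem lam φ) {M : ℕ}
    {ψ : Fin M → L2Field U q} (hψ : Orthonormal ℝ ψ)
    (hTψ : ∀ i : Fin M, covCLM w (ψ i) = lam i • ψ i) :
    projError w (Submodule.span ℝ (Set.range ψ)) = √(∑' k, lam (M + k)) := by
  refine (eq_sqrt_iff_of_sq_eq (norm_nonneg _) (h.tail_nonneg M) (h.projError_sq_eq hψ)).2 ?_
  rw [Finset.sum_range]
  refine Finset.sum_congr rfl fun i _ => ?_
  rw [hTψ, real_inner_smul_left, real_inner_self_eq_norm_sq, hψ.1, one_pow, mul_one]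

theorem projError_span_image_Iio (h : (covCLM w).IsEigensystem lam φ) (M : ℕ) :
    projError w (Submodule.span ℝ (φ '' Set.Iio M)) = √(∑' k, lam (M + k)) := by
  rw [image_Iio_eq_range]
  exact h.projError_span_eq (h.orthonormal.comp _ Fin.val_injective) fun i => h.eigen i

theorem finrank_span_image_Iio (h : (covCLM w).IsEigensystem lam φ) (M : ℕ) :
    Module.finrank ℝ (Submodule.span ℝ (φ '' Set.Iio M)) = M := by
  have hφ : Orthonormal ℝ fun i : Fin M => φ i := h.orthonormal.comp _ Fin.val_injective
  rw [image_Iio_eq_range, finrank_span_eq_card hφ.linearIndependent, Fintype.card_fin]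

theorem sqrt_tail_le_projError (h : (covCLM w).IsEigensystem lam φ) {M : ℕ}
    (H : Submodule ℝ (L2Field U q)) [FiniteDimensional ℝ H] (hM : Module.finrank ℝ H = M) :
    √(∑' k, lam (M + k)) ≤ projError w H ∧
      (projError w H = √(∑' k, lam (M + k)) →
        ∃ ψ : Fin M → L2Field U q, Orthonormal ℝ ψ ∧
          (∀ i : Fin M, covCLM w (ψ i) = lam i • ψ i) ∧ H = Submodule.span ℝ (Set.range ψ)) := by
  let b : OrthonormalBasis (Fin M) ℝ H := (stdOrthonormalBasis ℝ H).reindex (finCongr hM)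
  obtain ⟨hle, heq⟩ := h.trace_le (isPositive_covCLM w) (isCompactOperator_covCLM w) b
  have hsq := h.projError_sq_eq b.orthonormal_coe
  rw [b.span_range_coe] at hsq
  have hpos : 0 ≤ projError w H := norm_nonneg _
  refine ⟨(Real.sqrt_le_left hpos).2 (by linarith), fun he => heq ?_⟩
  exact (eq_sqrt_iff_of_sq_eq hpos (h.tail_nonneg M) hsq).1 he

end ContinuousLinearMap.IsEigensystem

end Optimality

section Coefficients

variable [IsProbabilityMeasure P] (v : RandomField P U q) {lam : ℕ → ℝ} {φ : ℕ → L2Field U q}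

theorem klCoeff_ae_eq (μ : ℝ) (u : L2Field U q) :
    klCoeff v μ u =ᵐ[P] fun ω => (√μ)⁻¹ * inner ℝ u (centered v ω) := by
  filter_upwards [centered_ae_eq v] with ω hω
  rw [klCoeff, hω, real_inner_comm, L2.inner_def]
  congr 1
  refine integral_congr_ae ?_
  filter_upwards [Lp.coeFn_sub (v ω) (meanField v)] with x hx
  rw [hx, Pi.sub_apply]

theorem memLp_klCoeff (μ : ℝ) (u : L2Field U q) : MemLp (klCoeff v μ u) 2 P :=
  (((Lp.memLp (centered v)).const_inner u).const_mul _).ae_eq (klCoeff_ae_eq v μ u).symm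

theorem integral_klCoeff (μ : ℝ) (u : L2Field U q) : ∫ ω, klCoeff v μ u ω ∂P = 0 := by
  rw [integral_congr_ae (klCoeff_ae_eq v μ u), integral_const_mul, integral_inner_centered,
    mul_zero]

variable {v} (h : (covCLM (centered v)).IsEigensystem lam φ)
include h

/-- Positivity of `lam k` alone is enough: off the diagonal ⟨φ k, w⟩ and ⟨φ l, w⟩ are uncorrelated,
whatever the scaling. -/
theorem integral_klCoeff_mul_klCoeff {k l : ℕ} (hk : 0 < lam k) :
    ∫ ω, klCoeff v (lam k) (φ k) ω * klCoeff v (lam l) (φ l) ω ∂P = if k = l then 1 else 0 := by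
  have heq : (fun ω => klCoeff v (lam k) (φ k) ω * klCoeff v (lam l) (φ l) ω) =ᵐ[P]
      fun ω => ((√(lam k))⁻¹ * (√(lam l))⁻¹) *
        (inner ℝ (φ k) (centered v ω) * inner ℝ (φ l) (centered v ω)) := by
    filter_upwards [klCoeff_ae_eq v (lam k) (φ k), klCoeff_ae_eq v (lam l) (φ l)] with ω h1 h2
    rw [h1, h2]
    ring
  rw [integral_congr_ae heq, integral_const_mul, ← inner_covCLM_apply_eq_integral,
    h.inner_apply_self]
  split_ifs with hkl
  · subst hkl
    rw [← mul_inv, Real.mul_self_sqrt hk.le, mul_one, inv_mul_cancel₀ hk.ne']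
  · simp

/-- When `lam k` is zero the left side is zero, and ⟨φ k, w⟩ vanishes almost surely because its
variance is `lam k`. Hence the expansion needs no separate treatment of zero eigenvalues. -/
theorem sqrt_mul_klCoeff_ae_eq (k : ℕ) :
    (fun ω => √(lam k) * klCoeff v (lam k) (φ k) ω) =ᵐ[P]
      fun ω => inner ℝ (φ k) (centered v ω) := by
  rcases (h.nonneg k).eq_or_lt with h0 | h0
  · have hzero : coeffOp (centered v) (φ k) = 0 := by
      rw [← inner_self_eq_zero (𝕜 := ℝ), ← inner_covCLM_apply, h.inner_apply_self, ← h0, zero_mul]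
    filter_upwards [coeffOp_ae_eq (centered v) (φ k), Lp.coeFn_zero ℝ 2 P] with ω h1 h2
    rw [← h1, hzero, h2, ← h0]
    simp
  · filter_upwards [klCoeff_ae_eq v (lam k) (φ k)] with ω h1
    rw [h1, mul_inv_cancel_left₀ (Real.sqrt_pos.2 h0).ne']

/-- The Karhunen-Loève expansion converges unconditionally. -/
theorem tendsto_eLpNorm_klExpansion :
    Tendsto (fun s : Finset ℕ => eLpNorm (fun ω => v ω - (meanField v +
      ∑ k ∈ s, (√(lam k) * klCoeff v (lam k) (φ k) ω) • φ k)) 2 P) atTop (𝓝 0) := by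
  have hterm : ∀ k, MemLp (fun ω => (√(lam k) * klCoeff v (lam k) (φ k) ω) • φ k) 2 P := fun k =>
    ContinuousLinearMap.comp_memLp' (ContinuousLinearMap.toSpanSingleton ℝ (φ k))
      (f := fun ω => √(lam k) * klCoeff v (lam k) (φ k) ω)
      ((memLp_klCoeff v (lam k) (φ k)).const_mul (√(lam k)))
  have hmem : ∀ s : Finset ℕ, MemLp (fun ω => v ω - (meanField v +
      ∑ k ∈ s, (√(lam k) * klCoeff v (lam k) (φ k) ω) • φ k)) 2 P := fun s => by
    have hsum := memLp_finsetSum s fun k _ => hterm k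
    exact (Lp.memLp v).sub ((memLp_const (meanField v)).add hsum)
  -- The identity holds for arbitrary finite index sets, so the net limit follows from the
  -- eigenvalues summing to the total variance.
  have hnorm : ∀ s : Finset ℕ,
      ‖(hmem s).toLp‖ ^ 2 = ‖centered v‖ ^ 2 - ∑ k ∈ s, lam k := fun s => by
    rw [norm_sub_sum_inner_smul_sq h.orthonormal s (centered v)]
    · simp [h.inner_apply_self]
    · filter_upwards [(hmem s).coeFn_toLp, centered_ae_eq v,
        ae_all_iff.2 (sqrt_mul_klCoeff_ae_eq h)] with ω h1 h2 h3
      rw [h1, sub_add_eq_sub_sub, ← h2]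
      simp only [h3]
  have h0 : Tendsto (fun s : Finset ℕ => √(‖centered v‖ ^ 2 - ∑ k ∈ s, lam k)) atTop (𝓝 0) := by
    have hs : Tendsto (fun s : Finset ℕ => ∑ k ∈ s, lam k) atTop (𝓝 (‖centered v‖ ^ 2)) :=
      h.hasSum_eigenvalues
    rw [← Real.sqrt_zero, ← sub_self (‖centered v‖ ^ 2)]
    exact (tendsto_const_nhds.sub hs).sqrt
  have hlim : Tendsto (fun s : Finset ℕ => ‖(hmem s).toLp‖) atTop (𝓝 0) :=
    h0.congr fun s => by rw [← hnorm s, Real.sqrt_sq (norm_nonneg _)]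
  have h2 := ENNReal.tendsto_ofReal hlim
  rw [ENNReal.ofReal_zero] at h2
  refine h2.congr fun s => ?_
  rw [Lp.norm_toLp, ENNReal.ofReal_toReal (hmem s).2.ne]

end Coefficients

end RandomFields

/-! ### The Karhunen–Loève theorem -/

theorem mainTheorem1 {d q : ℕ} (hd : 0 < d) (hq : 0 < q)
    {Ω : Type*} [MeasurableSpace Ω] (P : Measure Ω) [IsProbabilityMeasure P]
    (U : Set (EuclideanSpace ℝ (Fin d))) (hU : IsOpen U) (hUne : U.Nonempty)
    (v : RandomField P U q) :
    (∃ V, IsPointwiseVersion v V) ∧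
    ∀ V, IsPointwiseVersion v V →
      -- the mean, the covariance function and the covariance operator are well defined
      (∀ᵐ x ∂(volume.restrict U), MemLp (V x) 2 P ∧ meanField v x = ∫ ω, V x ω ∂P) ∧
      (∀ i j, MemLp (fun z : EuclideanSpace ℝ (Fin d) × EuclideanSpace ℝ (Fin d) =>
        covMatrix P V z.1 z.2 i j) 2 ((volume.restrict U).prod (volume.restrict U))) ∧
      (∀ u : L2Field U q, MemLp (covOp P U V u) 2 (volume.restrict U)) ∧
      -- the eigenpairs exist
      (∃ (lam : ℕ → ℝ) (φ : ℕ → L2Field U q), IsCovEigensystem P V lam φ) ∧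
      ∀ (lam : ℕ → ℝ) (φ : ℕ → L2Field U q), IsCovEigensystem P V lam φ →
        Summable lam ∧
        -- the coefficients
        (∀ k, MemLp (klCoeff v (lam k) (φ k)) 2 P) ∧
        (∀ k, 0 < lam k → ∫ ω, klCoeff v (lam k) (φ k) ω ∂P = 0) ∧
        (∀ k l, 0 < lam k → 0 < lam l →
          ∫ ω, klCoeff v (lam k) (φ k) ω * klCoeff v (lam l) (φ l) ω ∂P
            = if k = l then 1 else 0) ∧
        -- the expansion, converging unconditionally in the Bochner space
        Tendsto (fun s : Finset ℕ => eLpNorm (fun ω => v ω - (meanField v +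
            ∑ k ∈ s, (Real.sqrt (lam k) * klCoeff v (lam k) (φ k) ω) • φ k)) 2 P)
          atTop (𝓝 0) ∧
        -- optimality of the truncated expansion
        ∀ M : ℕ,
          IsLeast {e : ℝ | ∃ H : Submodule ℝ (L2Field U q), FiniteDimensional ℝ H ∧
              Module.finrank ℝ H = M ∧ e = projError (v - Lp.const 2 P (meanField v)) H}
            (Real.sqrt (∑' k, lam (M + k))) ∧
          projError (v - Lp.const 2 P (meanField v)) (Submodule.span ℝ (φ '' Set.Iio M))
            = Real.sqrt (∑' k, lam (M + k)) ∧
          ∀ H : Submodule ℝ (L2Field U q), FiniteDimensional ℝ H → Module.finrank ℝ H = M →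
            (projError (v - Lp.const 2 P (meanField v)) H = Real.sqrt (∑' k, lam (M + k)) ↔
              ∃ ψ : Fin M → L2Field U q, Orthonormal ℝ ψ ∧
                (∀ i : Fin M, CovEigen P V (lam i) (ψ i)) ∧
                H = Submodule.span ℝ (Set.range ψ)) ∧
            ((∀ i < M, lam M < lam i) →
              projError (v - Lp.const 2 P (meanField v)) H = Real.sqrt (∑' k, lam (M + k)) →
              H = Submodule.span ℝ (φ '' Set.Iio M)) := by
  refine ⟨exists_isPointwiseVersion v, fun V hV => ⟨hV.ae_memLp, hV.memLp_covMatrix,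
    fun u => (Lp.memLp (covCLM (centered v) u)).ae_eq (hV.covOp_ae_eq u).symm, ?_, ?_⟩⟩
  · obtain ⟨lam, φ, h⟩ := (isPositive_covCLM (centered v)).exists_isEigensystem
      (isCompactOperator_covCLM _) (not_finiteDimensional_L2Field hd hq hU hUne)
    exact ⟨lam, φ, (hV.isCovEigensystem_iff lam φ).2 h⟩
  intro lam φ hsys
  have h := (hV.isCovEigensystem_iff lam φ).1 hsys
  simp only [hV.covEigen_iff]
  refine ⟨h.hasSum_eigenvalues.summable, fun k => memLp_klCoeff v _ _,
    fun k _ => integral_klCoeff v _ _, fun k l hk _ => integral_klCoeff_mul_klCoeff h hk,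
    tendsto_eLpNorm_klExpansion h, fun M => ?_⟩
  have hfin : FiniteDimensional ℝ (Submodule.span ℝ (φ '' Set.Iio M)) :=
    FiniteDimensional.span_of_finite ℝ ((Set.finite_Iio M).image φ)
  refine ⟨⟨⟨_, hfin, h.finrank_span_image_Iio M, (h.projError_span_image_Iio M).symm⟩, ?_⟩,
    h.projError_span_image_Iio M, fun H hH hM => ⟨⟨(h.sqrt_tail_le_projError H hM).2, ?_⟩, ?_⟩⟩
  · rintro _ ⟨H, hH, hM, rfl⟩
    exact (h.sqrt_tail_le_projError H hM).1
  · rintro ⟨ψ, hψ, hTψ, rfl⟩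
    exact h.projError_span_eq hψ hTψ
  · intro hgap he
    obtain ⟨ψ, hψ, hTψ, rfl⟩ := (h.sqrt_tail_le_projError H hM).2 he
    exact h.span_eq_of_gap (isPositive_covCLM _) hgap hψ hTψ
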